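/- Let $n\ge 0$ and $m\ge 1$ be integers (the case $n=0$ is trivial). **Notation.** $\mathbf{Sp}(2n,R)$ is the symplectic group over $R$, written in $n\times n$ blocks, and $\tau\left(\begin{smallmatrix}A&B\\C&D\end{smallmatrix}\right)=\left(\begin{smallmatrix}A&-B\\-C&D\end{smallmatrix}\right)$ is its involution. $\mathbf{GL}(n,R)$ is embedded in $\mathbf{Sp}(2n,R)$ by $A\mapsto\mathrm{diag}(A,{}^tA^{-1})$. $\mathfrak h_n$ is the Siegel upper half-space of symmetric complex $n\times n$ matrices with positive definite imaginary part, on which $\mathbf{Sp}(2n,\mathbb R)$ acts by $gZ=(AZ+B)(CZ+D)^{-1}$ and which carries the involution $\tau(Z)=-\overline Z$; one has $\tau(gZ)=\tau(g)\tau(Z)$. $C_n$ is the cone of positive definite symmetric real $n\times n$ matrices, with $\mathbf{GL}(n,\mathbb R)$ acting by $A\cdot Y=AY\,{}^tA$, and $iC_n=\{iY: Y\in C_n\}\subset\mathfrak h_n$. $\Gamma(N)\subset\mathbf{Sp}(2n,\mathbb Z)$ and $\Gamma_\ell(N)\subset\mathbf{GL}(n,\mathbb Z)\subset\mathbf{Sp}(2n,\mathbb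 Z)$ are the principal congruence subgroups of level $N$, and $\Gamma_{2m}(2)$ is the group of $\left(\begin{smallmatrix}A&B\\C&D\end{smallmatrix}\right)\in\mathbf{Sp}(2n,\mathbb Z)$ with $A,D\equiv I \pmod 2$ and $B,C\equiv 0\pmod{2m}$. For $\gamma\in\mathbf{Sp}(2n,\mathbb R)$ put $\mathfrak h_n^\gamma=\{Z\in\mathfrak h_n:\gamma Z=\tau(Z)\}$. Let $X=\Gamma(4m)\backslash\mathfrak h_n$ with the involution induced by $\tau$, and let $X_{\mathbb R}\subset X$ be the set of its fixed points. All quotients carry the quotient topology and all subsets the subspace topology. $H^1(\mathbb C/\mathbb R,\Gamma(4m))$ is the nonabelian cohomology set of $\mathrm{Gal}(\mathbb C/\mathbb R)$ acting on $\Gamma(4m)$, complex conjugation $c$ acting by $\tau$: the cocycles are the maps $f:\mathrm{Gal}(\mathbb C/\mathbb R)\to\Gamma(4m)$ with $f(st)=s(f(t))f(s)$, and $f,f'$ are cohomologous if there is $h\in\Gamma(4m)$ with $f'(s)=s(h)f(s)h^{-1}$ for all $s$. For $\gamma\in\Gamma(4m)$ with $\gamma\tau(\gamma)=I$, let $f_\gamma$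 be the cocycle with $f_\gamma(1)=I$ and $f_\gamma(c)=\gamma$. For $g\in\Gamma_{2m}(2)$ let ${}^g\Gamma_\ell(4m)=g\Gamma_\ell(4m)g^{-1}$, which acts on $g\cdot iC_n$. **Theorem.** 1. $X_{\mathbb R}$ is the image in $X$ of $\bigcup_{\gamma\in\Gamma(4m)}\mathfrak h_n^\gamma$. 2. The double coset space $\Gamma(4m)\backslash\Gamma_{2m}(2)/\Gamma_\ell(2)$ is finite, and $g\mapsto [f_\gamma]$ with $\gamma=\tau(g)g^{-1}$ induces a well-defined bijection $$\Gamma(4m)\backslash\Gamma_{2m}(2)/\Gamma_\ell(2)\;\cong\; H^1(\mathbb C/\mathbb R,\Gamma(4m)).$$ 3. For every $g\in\Gamma_{2m}(2)$ the element $\gamma=\tau(g)g^{-1}$ lies in $\Gamma(4m)$ and $\mathfrak h_n^\gamma=g\cdot iC_n$. Moreover $Y\mapsto g\cdot iY$ induces a homeomorphism $\Gamma_\ell(4m)\backslash C_n\cong{}^g\Gamma_\ell(4m)\backslash g\cdot iC_n$. 4. For every choice of representatives $g\in\Gamma_{2m}(2)$ of these double cosets, the inclusions $g\cdot iC_n\subset\mathfrak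 h_n$ induce a homeomorphism $$\coprod_{g\in\Gamma(4m)\backslash\Gamma_{2m}(2)/\Gamma_\ell(2)}{}^g\Gamma_\ell(4m)\backslash g\cdot iC_n\;\cong\; X_{\mathbb R}.$$ Thus $X_{\mathbb R}$ is a disjoint union of finitely many copies of $\Gamma_\ell(4m)\backslash C_n$, the copy indexed by $g$ corresponding to the cohomology class of $f_\gamma$, $\gamma=\tau(g)g^{-1}$. -/

import Mathlib

namespace SiegelReal

open Matrix

/-! ### The symplectic group, its involution, and the general linear group inside it -/

/-- The symplectic group `Sp(2n, R)`. -/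
abbrev Sp (n : ℕ) (R : Type) [CommRing R] : Type := ↥(Matrix.symplecticGroup (Fin n) R)

/-- Change of coefficients `Sp(2n, R) → Sp(2n, S)`. -/
def spMap (n : ℕ) {R S : Type} [CommRing R] [CommRing S] (f : R →+* S) : Sp n R →* Sp n S where
  toFun g := ⟨g.1.map f, SymplecticGroup.map_mem g.2 f⟩
  map_one' := by
    apply Subtype.ext
    simp [Matrix.map_one]
  map_mul' g h := by
    apply Subtype.ext
    simp [Matrix.map_mul]

/-- The inclusion `Sp(2n, ℤ) → Sp(2n, ℝ)`. -/
def toReal (n : ℕ) : Sp n ℤ →* Sp n ℝ := spMap n (Int.castRingHom ℝ)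

/-- The matrix `I₋ = diag(-I, I)`. -/
def Iminus (n : ℕ) (R : Type) [CommRing R] : Matrix (Fin n ⊕ Fin n) (Fin n ⊕ Fin n) R :=
  fromBlocks (-1) 0 0 1

lemma Iminus_mul_self (n : ℕ) (R : Type) [CommRing R] : Iminus n R * Iminus n R = 1 := by
  simp [Iminus, fromBlocks_multiply]

lemma conj_Iminus_mem {n : ℕ} {R : Type} [CommRing R] (g : Sp n R) :
    Iminus n R * g.1 * Iminus n R ∈ Matrix.symplecticGroup (Fin n) R := by
  have hJ : Iminus n R * J (Fin n) R * Iminus n R = - J (Fin n) R := by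
    simp [Iminus, J, fromBlocks_multiply, fromBlocks_neg]
  have hT : (Iminus n R)ᵀ = Iminus n R := by
    simp [Iminus, fromBlocks_transpose]
  have hg := SymplecticGroup.mem_iff.1 g.2
  rw [SymplecticGroup.mem_iff, transpose_mul, transpose_mul, hT]
  calc Iminus n R * g.1 * Iminus n R * J (Fin n) R * (Iminus n R * (g.1ᵀ * Iminus n R))
      = Iminus n R * (g.1 * (Iminus n R * J (Fin n) R * Iminus n R) * g.1ᵀ) * Iminus n R := by
        simp only [Matrix.mul_assoc]
    _ = J (Fin n) R := by
        rw [hJ, Matrix.mul_neg, Matrix.neg_mul, hg, Matrix.mul_neg, Matrix.neg_mul, hJ, neg_neg]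

/-- The involution `τ(g) = I₋ g I₋` of `Sp(2n, R)`. -/
def tau {n : ℕ} {R : Type} [CommRing R] : Sp n R →* Sp n R where
  toFun g := ⟨Iminus n R * g.1 * Iminus n R, conj_Iminus_mem g⟩
  map_one' := by
    apply Subtype.ext
    simp [Iminus_mul_self]
  map_mul' g h := by
    apply Subtype.ext
    change Iminus n R * (g.1 * h.1) * Iminus n R
      = Iminus n R * g.1 * Iminus n R * (Iminus n R * h.1 * Iminus n R)
    calc Iminus n R * (g.1 * h.1) * Iminus n R
        = Iminus n R * g.1 * (1 : Matrix (Fin n ⊕ Fin n) (Fin n ⊕ Fin n) R) * h.1 * Iminus n R := by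
          simp only [Matrix.mul_assoc, Matrix.one_mul]
      _ = _ := by
          rw [← Iminus_mul_self]
          simp only [Matrix.mul_assoc]

lemma tau_tau {n : ℕ} {R : Type} [CommRing R] (g : Sp n R) : tau (tau g) = g := by
  apply Subtype.ext
  change Iminus n R * (Iminus n R * g.1 * Iminus n R) * Iminus n R = g.1
  calc Iminus n R * (Iminus n R * g.1 * Iminus n R) * Iminus n R
      = (Iminus n R * Iminus n R) * g.1 * (Iminus n R * Iminus n R) := by
        simp only [Matrix.mul_assoc]
    _ = g.1 := by simp [Iminus_mul_self]

lemma tau_spMap {n : ℕ} {R S : Type} [CommRing R] [CommRing S] (f : R →+* S) (g : Sp n R) :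
    tau (spMap n f g) = spMap n f (tau g) := by
  apply Subtype.ext
  have h : (Iminus n R).map f = Iminus n S := by
    simp [Iminus, fromBlocks_map, Matrix.map_neg]
  change Iminus n S * g.1.map f * Iminus n S = (Iminus n R * g.1 * Iminus n R).map f
  rw [Matrix.map_mul, Matrix.map_mul, h]

/-- The embedding `A ↦ diag(A, ᵗA⁻¹)` of `GL(n, R)` in `Sp(2n, R)`. -/
def glEmb (n : ℕ) (R : Type) [CommRing R] : GL (Fin n) R →* Sp n R where
  toFun A := ⟨fromBlocks A.1 0 0 (A⁻¹).1ᵀ, by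
    rw [SymplecticGroup.fromBlocks_mem_iff]
    refine ⟨by simp, by simp, ?_⟩
    have h : (A⁻¹).1 * A.1 = 1 := by
      rw [← Units.val_mul, inv_mul_cancel, Units.val_one]
    rw [← transpose_mul, h]
    simp⟩
  map_one' := by
    apply Subtype.ext
    simp
  map_mul' A B := by
    apply Subtype.ext
    simp only [_root_.mul_inv_rev, Units.val_mul, transpose_mul, Submonoid.coe_mul, fromBlocks_multiply]
    simp

/-! ### The arithmetic groups -/

/-- `Γ(N)`, the principal congruence subgroup of level `N` of `Sp(2n, ℤ)`. -/
def Gam (n N : ℕ) : Subgroup (Sp n ℤ) := (spMap n (Int.castRingHom (ZMod N))).ker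

/-- `Γ_ℓ(N)`, the principal congruence subgroup of level `N` of `GL(n, ℤ)`. -/
def GamL (n N : ℕ) : Subgroup (GL (Fin n) ℤ) :=
  (GeneralLinearGroup.map (Int.castRingHom (ZMod N))).ker

/-- `Γ_ℓ(N)`, as a subgroup of `Sp(2n, ℤ)`. -/
def GamLSp (n N : ℕ) : Subgroup (Sp n ℤ) := (GamL n N).map (glEmb n ℤ)

lemma toBlocks_mul {n : ℕ} {R : Type} [CommRing R] (M N : Matrix (Fin n ⊕ Fin n) (Fin n ⊕ Fin n) R) :
    (M * N).toBlocks₁₁ = M.toBlocks₁₁ * N.toBlocks₁₁ + M.toBlocks₁₂ * N.toBlocks₂₁ ∧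
    (M * N).toBlocks₁₂ = M.toBlocks₁₁ * N.toBlocks₁₂ + M.toBlocks₁₂ * N.toBlocks₂₂ ∧
    (M * N).toBlocks₂₁ = M.toBlocks₂₁ * N.toBlocks₁₁ + M.toBlocks₂₂ * N.toBlocks₂₁ ∧
    (M * N).toBlocks₂₂ = M.toBlocks₂₁ * N.toBlocks₁₂ + M.toBlocks₂₂ * N.toBlocks₂₂ := by
  have h := fromBlocks_multiply M.toBlocks₁₁ M.toBlocks₁₂ M.toBlocks₂₁ M.toBlocks₂₂
    N.toBlocks₁₁ N.toBlocks₁₂ N.toBlocks₂₁ N.toBlocks₂₂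
  rw [fromBlocks_toBlocks, fromBlocks_toBlocks] at h
  rw [h]
  simp

lemma dvd_add_mat {n : ℕ} {d : ℤ} {M N : Matrix (Fin n) (Fin n) ℤ} (hM : ∀ i j, d ∣ M i j)
    (hN : ∀ i j, d ∣ N i j) : ∀ i j, d ∣ (M + N) i j :=
  fun i j => dvd_add (hM i j) (hN i j)

lemma dvd_mul_right_mat {n : ℕ} {d : ℤ} {M : Matrix (Fin n) (Fin n) ℤ} (hM : ∀ i j, d ∣ M i j)
    (N : Matrix (Fin n) (Fin n) ℤ) : ∀ i j, d ∣ (M * N) i j :=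
  fun i j => by
    rw [Matrix.mul_apply]
    exact Finset.dvd_sum fun k _ => (hM i k).mul_right _

lemma dvd_mul_left_mat {n : ℕ} {d : ℤ} {M : Matrix (Fin n) (Fin n) ℤ} (hM : ∀ i j, d ∣ M i j)
    (N : Matrix (Fin n) (Fin n) ℤ) : ∀ i j, d ∣ (N * M) i j :=
  fun i j => by
    rw [Matrix.mul_apply]
    exact Finset.dvd_sum fun k _ => (hM k j).mul_left _

/-- `Γ_{2m}(2)`: the matrices in `Sp(2n, ℤ)` whose diagonal blocks are congruent to `I` modulo `2`
and whose off-diagonal blocks are congruent to `0` modulo `2m`. -/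
def Gam2 (n m : ℕ) : Subgroup (Sp n ℤ) where
  carrier := {g | (∀ i j, (2 : ℤ) ∣ (g.1.toBlocks₁₁ - 1) i j) ∧
    (∀ i j, (2 : ℤ) ∣ (g.1.toBlocks₂₂ - 1) i j) ∧
    (∀ i j, (2 * m : ℤ) ∣ g.1.toBlocks₁₂ i j) ∧
    (∀ i j, (2 * m : ℤ) ∣ g.1.toBlocks₂₁ i j)}
  one_mem' := by
    have h : (1 : Sp n ℤ).1 = fromBlocks 1 0 0 1 := fromBlocks_one.symm
    refine ⟨?_, ?_, ?_, ?_⟩ <;> rw [h] <;>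
      simp only [toBlocks_fromBlocks₁₁, toBlocks_fromBlocks₁₂, toBlocks_fromBlocks₂₁,
        toBlocks_fromBlocks₂₂] <;> simp
  mul_mem' := by
    rintro g h ⟨g1, g2, g3, g4⟩ ⟨h1, h2, h3, h4⟩
    obtain ⟨e1, e2, e3, e4⟩ := toBlocks_mul g.1 h.1
    have two : ∀ {x : ℤ}, (2 * m : ℤ) ∣ x → (2 : ℤ) ∣ x := fun hx => (Dvd.intro _ rfl).trans hx
    refine ⟨?_, ?_, ?_, ?_⟩
    · have : (g * h).1.toBlocks₁₁ - 1 = (g.1.toBlocks₁₁ - 1) * h.1.toBlocks₁₁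
          + (h.1.toBlocks₁₁ - 1) + g.1.toBlocks₁₂ * h.1.toBlocks₂₁ := by
        rw [Submonoid.coe_mul, e1]
        noncomm_ring
      rw [this]
      exact dvd_add_mat (dvd_add_mat (dvd_mul_right_mat g1 _) h1)
        (dvd_mul_right_mat (fun i j => two (g3 i j)) _)
    · have : (g * h).1.toBlocks₂₂ - 1 = g.1.toBlocks₂₁ * h.1.toBlocks₁₂
          + ((g.1.toBlocks₂₂ - 1) * h.1.toBlocks₂₂ + (h.1.toBlocks₂₂ - 1)) := by
        rw [Submonoid.coe_mul, e4]
        noncomm_ring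
      rw [this]
      exact dvd_add_mat (dvd_mul_right_mat (fun i j => two (g4 i j)) _)
        (dvd_add_mat (dvd_mul_right_mat g2 _) h2)
    · rw [Submonoid.coe_mul, e2]
      exact dvd_add_mat (dvd_mul_left_mat h3 _) (dvd_mul_right_mat g3 _)
    · rw [Submonoid.coe_mul, e3]
      exact dvd_add_mat (dvd_mul_right_mat g4 _) (dvd_mul_left_mat h4 _)
  inv_mem' := by
    rintro g ⟨g1, g2, g3, g4⟩
    have e : (g⁻¹).1 = fromBlocks g.1.toBlocks₂₂ᵀ (-g.1.toBlocks₁₂ᵀ) (-g.1.toBlocks₂₁ᵀ)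
        g.1.toBlocks₁₁ᵀ := by
      rw [SymplecticGroup.coe_inv]
      conv_lhs => rw [← fromBlocks_toBlocks g.1]
      simp [J, fromBlocks_transpose, fromBlocks_multiply, fromBlocks_neg]
    refine ⟨fun i j => ?_, fun i j => ?_, fun i j => ?_, fun i j => ?_⟩
    · rw [e, toBlocks_fromBlocks₁₁]
      simpa [Matrix.one_apply, eq_comm] using g2 j i
    · rw [e, toBlocks_fromBlocks₂₂]
      simpa [Matrix.one_apply, eq_comm] using g1 j i
    · rw [e, toBlocks_fromBlocks₁₂]
      simpa using g3 j i
    · rw [e, toBlocks_fromBlocks₂₁]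
      simpa using g4 j i

/-! ### The Siegel upper half-space -/

/-- The Siegel upper half-space: symmetric complex matrices with positive definite
imaginary part. -/
def Siegel (n : ℕ) : Type :=
  {Z : Matrix (Fin n) (Fin n) ℂ // Zᵀ = Z ∧ (Z.map Complex.im).PosDef}

instance (n : ℕ) : TopologicalSpace (Siegel n) :=
  inferInstanceAs (TopologicalSpace {Z : Matrix (Fin n) (Fin n) ℂ // Zᵀ = Z ∧ (Z.map Complex.im).PosDef})

/-- `AZ + B`. -/
noncomputable def num {n : ℕ} (g : Sp n ℝ) (Z : Matrix (Fin n) (Fin n) ℂ) : Matrix (Fin n) (Fin n) ℂ :=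
  g.1.toBlocks₁₁.map (algebraMap ℝ ℂ) * Z + g.1.toBlocks₁₂.map (algebraMap ℝ ℂ)

/-- `CZ + D`. -/
noncomputable def den {n : ℕ} (g : Sp n ℝ) (Z : Matrix (Fin n) (Fin n) ℂ) : Matrix (Fin n) (Fin n) ℂ :=
  g.1.toBlocks₂₁.map (algebraMap ℝ ℂ) * Z + g.1.toBlocks₂₂.map (algebraMap ℝ ℂ)

lemma blocks_rel {n : ℕ} (g : Sp n ℝ) :
    let A := g.1.toBlocks₁₁.map (algebraMap ℝ ℂ)
    let B := g.1.toBlocks₁₂.map (algebraMap ℝ ℂ)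
    let C := g.1.toBlocks₂₁.map (algebraMap ℝ ℂ)
    let D := g.1.toBlocks₂₂.map (algebraMap ℝ ℂ)
    Aᵀ * C = Cᵀ * A ∧ Bᵀ * D = Dᵀ * B ∧ Aᵀ * D - Cᵀ * B = 1 := by
  have h := SymplecticGroup.map_mem g.2 (algebraMap ℝ ℂ)
  rw [← fromBlocks_toBlocks g.1, fromBlocks_map] at h
  exact SymplecticGroup.fromBlocks_mem_iff.1 h

lemma num_den_rel {n : ℕ} (g : Sp n ℝ) (W Z : Matrix (Fin n) (Fin n) ℂ) :
    (W * (g.1.toBlocks₂₁.map (algebraMap ℝ ℂ))ᵀ + (g.1.toBlocks₂₂.map (algebraMap ℝ ℂ))ᵀ) * num g Z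
    - (W * (g.1.toBlocks₁₁.map (algebraMap ℝ ℂ))ᵀ + (g.1.toBlocks₁₂.map (algebraMap ℝ ℂ))ᵀ)
      * den g Z = Z - W := by
  obtain ⟨h1, h2, h3⟩ := blocks_rel g
  have h4 := congrArg Matrix.transpose h3
  simp only [num, den]
  set A := g.1.toBlocks₁₁.map (algebraMap ℝ ℂ)
  set B := g.1.toBlocks₁₂.map (algebraMap ℝ ℂ)
  set C := g.1.toBlocks₂₁.map (algebraMap ℝ ℂ)
  set D := g.1.toBlocks₂₂.map (algebraMap ℝ ℂ)
  simp only [transpose_sub, transpose_mul, transpose_transpose, transpose_one] at h4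
  have e : (W * Cᵀ + Dᵀ) * (A * Z + B) - (W * Aᵀ + Bᵀ) * (C * Z + D)
      = W * (Cᵀ * A - Aᵀ * C) * Z - W * (Aᵀ * D - Cᵀ * B) + (Dᵀ * A - Bᵀ * C) * Z
        + (Dᵀ * B - Bᵀ * D) := by
    noncomm_ring
  rw [e, h1, h2, h3, h4]
  simp [sub_eq_neg_add]

lemma map_conjTranspose {n : ℕ} (M : Matrix (Fin n) (Fin n) ℝ) :
    (M.map (algebraMap ℝ ℂ))ᴴ = (M.map (algebraMap ℝ ℂ))ᵀ := by
  ext i j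
  simp [conjTranspose_apply]

open scoped ComplexOrder in
lemma posDef_map_complex {n : ℕ} {Y : Matrix (Fin n) (Fin n) ℝ} (h : Y.PosDef) :
    (Y.map (algebraMap ℝ ℂ)).PosDef := by
  have hs : ∀ i j, Y j i = Y i j := fun i j => by simpa using h.1.apply i j
  refine PosDef.of_dotProduct_mulVec_pos ?_ fun v hv => ?_
  · ext i j
    simp [conjTranspose_apply, hs]
  · set a : Fin n → ℝ := fun i => (v i).re with ha
    set b : Fin n → ℝ := fun i => (v i).im with hb
    have e1 : star v ⬝ᵥ (Y.map (algebraMap ℝ ℂ) *ᵥ v)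
        = ((a ⬝ᵥ (Y *ᵥ a) + b ⬝ᵥ (Y *ᵥ b) : ℝ) : ℂ) := by
      have hsym : a ⬝ᵥ (Y *ᵥ b) = b ⬝ᵥ (Y *ᵥ a) := by
        have hT : Yᵀ = Y := by
          ext i j
          exact hs i j
        rw [dotProduct_mulVec, ← mulVec_transpose, hT, dotProduct_comm]
      have hv' : ∀ i, v i = (a i : ℂ) + (b i : ℂ) * Complex.I := fun i => (Complex.re_add_im _).symm
      apply Complex.ext
      · simp only [dotProduct, mulVec, Complex.ofReal_re, Finset.mul_sum, Complex.re_sum,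
          ← Finset.sum_add_distrib]
        refine Finset.sum_congr rfl fun i _ => Finset.sum_congr rfl fun j _ => ?_
        simp [hv']
      · have : a ⬝ᵥ (Y *ᵥ b) - b ⬝ᵥ (Y *ᵥ a) = 0 := by rw [hsym, sub_self]
        rw [Complex.ofReal_im, ← this]
        simp only [dotProduct, mulVec, Finset.mul_sum, Complex.im_sum,
          ← Finset.sum_sub_distrib]
        refine Finset.sum_congr rfl fun i _ => Finset.sum_congr rfl fun j _ => ?_
        simp [hv']
        ring
    rw [e1]
    have hnn : ∀ c : Fin n → ℝ, 0 ≤ c ⬝ᵥ (Y *ᵥ c) := fun c => by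
      simpa using h.posSemidef.dotProduct_mulVec_nonneg c
    have hpos : ∀ c : Fin n → ℝ, c ≠ 0 → 0 < c ⬝ᵥ (Y *ᵥ c) := fun c hc => by
      simpa using h.dotProduct_mulVec_pos hc
    have : 0 < a ⬝ᵥ (Y *ᵥ a) + b ⬝ᵥ (Y *ᵥ b) := by
      by_cases h0 : a = 0
      · have h1 : b ≠ 0 := fun h1 => hv (by
          ext i
          exact Complex.ext (congrFun h0 i) (congrFun h1 i))
        linarith [hnn a, hpos b h1]
      · linarith [hnn b, hpos a h0]
    exact_mod_cast this

open scoped ComplexOrder in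
lemma posDef_of_map_complex {n : ℕ} {Y : Matrix (Fin n) (Fin n) ℝ}
    (h : (Y.map (algebraMap ℝ ℂ)).PosDef) : Y.PosDef := by
  refine PosDef.of_dotProduct_mulVec_pos ?_ fun v hv => ?_
  · ext i j
    have := congrFun (congrFun h.1 i) j
    simpa [conjTranspose_apply] using this
  · have hv' : (fun i => (v i : ℂ)) ≠ 0 := fun h0 => hv (by
      ext i
      simpa using congrFun h0 i)
    have := h.dotProduct_mulVec_pos hv'
    have e : star (fun i => (v i : ℂ)) ⬝ᵥ (Y.map (algebraMap ℝ ℂ) *ᵥ fun i => (v i : ℂ))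
        = ((star v ⬝ᵥ (Y *ᵥ v) : ℝ) : ℂ) := by
      simp [dotProduct, mulVec]
    rw [e] at this
    exact_mod_cast this

/-- For a symmetric matrix, `Z - Zᴴ = 2i Im Z`. -/
lemma sub_conjTranspose {n : ℕ} {Z : Matrix (Fin n) (Fin n) ℂ} (h : Zᵀ = Z) :
    Z - Zᴴ = (2 * Complex.I) • (Z.map Complex.im).map (algebraMap ℝ ℂ) := by
  ext i j
  have hij : Z j i = Z i j := congrFun (congrFun h i) j
  simp only [Matrix.sub_apply, conjTranspose_apply, hij, Matrix.smul_apply, map_apply, smul_eq_mul]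
  apply Complex.ext <;> simp
  ring

lemma herm_rel {n : ℕ} (g : Sp n ℝ) (Z : Matrix (Fin n) (Fin n) ℂ) :
    (den g Z)ᴴ * num g Z - (num g Z)ᴴ * den g Z = Z - Zᴴ := by
  have := num_den_rel g Zᴴ Z
  rw [← map_conjTranspose, ← map_conjTranspose, ← map_conjTranspose, ← map_conjTranspose] at this
  rw [← this]
  simp [den, num, conjTranspose_add, conjTranspose_mul]

lemma symm_rel {n : ℕ} (g : Sp n ℝ) {Z : Matrix (Fin n) (Fin n) ℂ} (h : Zᵀ = Z) :
    (den g Z)ᵀ * num g Z = (num g Z)ᵀ * den g Z := by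
  have := num_den_rel g Zᵀ Z
  rw [h, sub_self, sub_eq_zero] at this
  simpa [den, num, transpose_add, transpose_mul, h] using this

open scoped ComplexOrder in
lemma isUnit_den {n : ℕ} (g : Sp n ℝ) (Z : Siegel n) : IsUnit (den g Z.1).det := by
  rw [isUnit_iff_ne_zero]
  intro h0
  obtain ⟨v, hv, hv0⟩ := exists_mulVec_eq_zero_iff.2 h0
  have h1 := herm_rel g Z.1
  rw [sub_conjTranspose Z.2.1] at h1
  have h2 := congrArg (fun M => star v ⬝ᵥ (M *ᵥ v)) h1
  simp only [sub_mulVec, ← mulVec_mulVec, hv0, mulVec_zero, sub_zero, smul_mulVec,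
    dotProduct_smul] at h2
  rw [dotProduct_mulVec, ← star_mulVec, hv0, star_zero, zero_dotProduct] at h2
  have h3 := (posDef_map_complex Z.2.2).dotProduct_mulVec_pos hv
  have h4 : (2 * Complex.I) ≠ 0 := by simp
  rw [eq_comm, smul_eq_mul, mul_eq_zero] at h2
  exact h3.ne' (h2.resolve_left h4)

open scoped ComplexOrder in
lemma smul_mem {n : ℕ} (g : Sp n ℝ) (Z : Siegel n) :
    (num g Z.1 * (den g Z.1)⁻¹)ᵀ = num g Z.1 * (den g Z.1)⁻¹ ∧
      ((num g Z.1 * (den g Z.1)⁻¹).map Complex.im).PosDef := by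
  have hu := isUnit_den g Z
  have hs := symm_rel g Z.2.1
  have hh := herm_rel g Z.1
  rw [sub_conjTranspose Z.2.1] at hh
  set P := num g Z.1
  set Q := den g Z.1
  have hQ : Q * Q⁻¹ = 1 := mul_nonsing_inv _ hu
  have hQt : (Q⁻¹)ᵀ * Qᵀ = 1 := by rw [← transpose_mul, hQ, transpose_one]
  have hQh : (Q⁻¹)ᴴ * Qᴴ = 1 := by rw [← conjTranspose_mul, hQ, conjTranspose_one]
  have hsym : (P * Q⁻¹)ᵀ = P * Q⁻¹ := by
    calc (P * Q⁻¹)ᵀ = (Q⁻¹)ᵀ * (Pᵀ * Q) * Q⁻¹ := by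
          rw [transpose_mul, Matrix.mul_assoc, Matrix.mul_assoc, hQ, Matrix.mul_one]
      _ = ((Q⁻¹)ᵀ * Qᵀ) * P * Q⁻¹ := by
          rw [← hs]
          simp only [Matrix.mul_assoc]
      _ = P * Q⁻¹ := by rw [hQt, Matrix.one_mul]
  refine ⟨hsym, posDef_of_map_complex ?_⟩
  have h4 : (2 * Complex.I) ≠ 0 := by simp
  have key : ((P * Q⁻¹).map Complex.im).map (algebraMap ℝ ℂ)
      = (Q⁻¹)ᴴ * (Z.1.map Complex.im).map (algebraMap ℝ ℂ) * Q⁻¹ := by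
    apply smul_right_injective _ h4
    change (2 * Complex.I) • _ = (2 * Complex.I) • _
    rw [← sub_conjTranspose hsym, ← Matrix.smul_mul, ← Matrix.mul_smul, ← hh, conjTranspose_mul]
    calc P * Q⁻¹ - (Q⁻¹)ᴴ * Pᴴ
        = ((Q⁻¹)ᴴ * Qᴴ) * P * Q⁻¹ - (Q⁻¹)ᴴ * Pᴴ * (Q * Q⁻¹) := by
          rw [hQ, hQh, Matrix.one_mul, Matrix.mul_one]
      _ = _ := by
          simp only [Matrix.mul_sub, Matrix.sub_mul, Matrix.mul_assoc]
  rw [key]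
  refine (posDef_map_complex Z.2.2).conjTranspose_mul_mul_same ?_
  intro v w hvw
  have := congrArg (fun x => Q *ᵥ x) hvw
  simpa [mulVec_mulVec, hQ] using this

lemma num_den_mul {n : ℕ} (g h : Sp n ℝ) (Z W : Matrix (Fin n) (Fin n) ℂ)
    (hW : W * den h Z = num h Z) :
    num (g * h) Z = num g W * den h Z ∧ den (g * h) Z = den g W * den h Z := by
  obtain ⟨h1, h2, h3, h4⟩ := toBlocks_mul g.1 h.1
  constructor
  · have : num g W * den h Z = g.1.toBlocks₁₁.map (algebraMap ℝ ℂ) * num h Z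
        + g.1.toBlocks₁₂.map (algebraMap ℝ ℂ) * den h Z := by
      rw [← hW, num, Matrix.add_mul, Matrix.mul_assoc]
    rw [this]
    simp only [num, den, Submonoid.coe_mul, h1, h2, Matrix.map_add _ (map_add _), Matrix.map_mul]
    noncomm_ring
  · have : den g W * den h Z = g.1.toBlocks₂₁.map (algebraMap ℝ ℂ) * num h Z
        + g.1.toBlocks₂₂.map (algebraMap ℝ ℂ) * den h Z := by
      rw [← hW, den, Matrix.add_mul, Matrix.mul_assoc]
    rw [this]
    simp only [num, den, Submonoid.coe_mul, h3, h4, Matrix.map_add _ (map_add _), Matrix.map_mul]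
    noncomm_ring

/-- The action `g Z = (AZ + B)(CZ + D)⁻¹` of `Sp(2n, ℝ)` on the Siegel upper half-space. -/
noncomputable instance (n : ℕ) : MulAction (Sp n ℝ) (Siegel n) where
  smul g Z := ⟨num g Z.1 * (den g Z.1)⁻¹, smul_mem g Z⟩
  one_smul Z := by
    apply Subtype.ext
    change num 1 Z.1 * (den 1 Z.1)⁻¹ = Z.1
    have h : (1 : Sp n ℝ).1 = fromBlocks 1 0 0 1 := fromBlocks_one.symm
    rw [num, den, h]
    simp only [toBlocks_fromBlocks₁₁, toBlocks_fromBlocks₁₂, toBlocks_fromBlocks₂₁,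
      toBlocks_fromBlocks₂₂]
    simp [Matrix.map_one, Matrix.map_zero]
  mul_smul g h Z := by
    apply Subtype.ext
    set W : Siegel n := ⟨num h Z.1 * (den h Z.1)⁻¹, smul_mem h Z⟩ with hWdef
    change num (g * h) Z.1 * (den (g * h) Z.1)⁻¹ = num g W.1 * (den g W.1)⁻¹
    have hu := isUnit_den h Z
    have hW : W.1 * den h Z.1 = num h Z.1 := by
      rw [hWdef, Matrix.mul_assoc, nonsing_inv_mul _ hu, Matrix.mul_one]
    obtain ⟨e1, e2⟩ := num_den_mul g h Z.1 W.1 hW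
    rw [e1, e2, Matrix.mul_inv_rev, Matrix.mul_assoc, ← Matrix.mul_assoc (den h Z.1),
      mul_nonsing_inv _ hu, Matrix.one_mul]

lemma coe_smul {n : ℕ} (g : Sp n ℝ) (Z : Siegel n) :
    (g • Z).1 = num g Z.1 * (den g Z.1)⁻¹ := rfl

/-- `Sp(2n, ℤ)` acts on the Siegel upper half-space as a subgroup of `Sp(2n, ℝ)`. -/
noncomputable instance (n : ℕ) : MulAction (Sp n ℤ) (Siegel n) :=
  MulAction.compHom (Siegel n) (toReal n)

/-- The involution `τ(Z) = -Z̄` of the Siegel upper half-space. -/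
def tauS {n : ℕ} (Z : Siegel n) : Siegel n :=
  ⟨-(Z.1.map (starRingEnd ℂ)), by
    constructor
    · ext i j
      have h : Z.1 j i = Z.1 i j := congrFun (congrFun Z.2.1 i) j
      simp [h]
    · convert Z.2.2 using 1
      ext i j
      simp⟩

lemma tauS_smul {n : ℕ} (g : Sp n ℝ) (Z : Siegel n) : tauS (g • Z) = tau g • tauS Z := by
  apply Subtype.ext
  have hb : (tau g).1 = fromBlocks g.1.toBlocks₁₁ (-g.1.toBlocks₁₂) (-g.1.toBlocks₂₁)
      g.1.toBlocks₂₂ := by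
    change Iminus n ℝ * g.1 * Iminus n ℝ = _
    conv_lhs => rw [← fromBlocks_toBlocks g.1]
    simp [Iminus, fromBlocks_multiply]
  have hc : ∀ M : Matrix (Fin n) (Fin n) ℝ,
      (M.map (algebraMap ℝ ℂ)).map (starRingEnd ℂ) = M.map (algebraMap ℝ ℂ) := fun M => by
    ext i j
    simp
  have hneg : ∀ M : Matrix (Fin n) (Fin n) ℝ,
      (-M).map (algebraMap ℝ ℂ) = -(M.map (algebraMap ℝ ℂ)) := fun M => by
    ext i j
    simp
  have hn : num (tau g) (tauS Z).1 = -(num g Z.1).map (starRingEnd ℂ) := by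
    simp only [num, hb, toBlocks_fromBlocks₁₁, toBlocks_fromBlocks₁₂, tauS, hneg,
      Matrix.map_add _ (map_add _), Matrix.map_mul, hc]
    noncomm_ring
  have hd : den (tau g) (tauS Z).1 = (den g Z.1).map (starRingEnd ℂ) := by
    simp only [den, hb, toBlocks_fromBlocks₂₁, toBlocks_fromBlocks₂₂, tauS, hneg,
      Matrix.map_add _ (map_add _), Matrix.map_mul, hc]
    noncomm_ring
  have hu := isUnit_den (tau g) (tauS Z)
  have h1 : (g • Z).1 * den g Z.1 = num g Z.1 := by
    rw [coe_smul, Matrix.mul_assoc, nonsing_inv_mul _ (isUnit_den g Z), Matrix.mul_one]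
  have h2 : (tauS (g • Z)).1 * den (tau g) (tauS Z).1 = num (tau g) (tauS Z).1 := by
    rw [hn, hd, ← h1, Matrix.map_mul]
    simp only [tauS, Matrix.neg_mul]
  rw [coe_smul, ← h2, Matrix.mul_assoc, mul_nonsing_inv _ hu, Matrix.mul_one]

/-! ### The cone of positive definite matrices -/

/-- The cone `C_n` of positive definite symmetric real matrices. -/
def Cone (n : ℕ) : Type := {Y : Matrix (Fin n) (Fin n) ℝ // Y.PosDef}

instance (n : ℕ) : TopologicalSpace (Cone n) :=
  inferInstanceAs (TopologicalSpace {Y : Matrix (Fin n) (Fin n) ℝ // Y.PosDef})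

/-- The action `A · Y = A Y ᵗA` of `GL(n, ℝ)` on `C_n`. -/
instance (n : ℕ) : MulAction (GL (Fin n) ℝ) (Cone n) where
  smul A Y := ⟨A.1 * Y.1 * A.1ᵀ, by
    have hA : A.1 * (A⁻¹).1 = 1 := by
      rw [← Units.val_mul, mul_inv_cancel, Units.val_one]
    have h := Y.2.mul_mul_conjTranspose_same (B := A.1) fun v w hvw => by
      have := congrArg (fun x => x ᵥ* (A⁻¹).1) hvw
      simpa [vecMul_vecMul, hA] using this
    simpa [conjTranspose_eq_transpose_of_trivial] using h⟩
  one_smul Y := by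
    apply Subtype.ext
    change (1 : Matrix (Fin n) (Fin n) ℝ) * Y.1 * (1 : Matrix (Fin n) (Fin n) ℝ)ᵀ = Y.1
    simp
  mul_smul A B Y := by
    apply Subtype.ext
    change (A.1 * B.1) * Y.1 * (A.1 * B.1)ᵀ = A.1 * (B.1 * Y.1 * B.1ᵀ) * A.1ᵀ
    simp only [transpose_mul, Matrix.mul_assoc]

/-- `GL(n, ℤ)` acts on `C_n` as a subgroup of `GL(n, ℝ)`. -/
instance (n : ℕ) : MulAction (GL (Fin n) ℤ) (Cone n) :=
  MulAction.compHom (Cone n) (GeneralLinearGroup.map (Int.castRingHom ℝ) :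
    GL (Fin n) ℤ →* GL (Fin n) ℝ)

/-- The map `Y ↦ iY` from `C_n` to the Siegel upper half-space. -/
noncomputable def iMul {n : ℕ} (Y : Cone n) : Siegel n :=
  ⟨Complex.I • Y.1.map (algebraMap ℝ ℂ), by
    constructor
    · ext i j
      have h : Y.1 j i = Y.1 i j := by simpa using Y.2.1.apply i j
      simp [h]
    · convert Y.2 using 1
      ext i j
      simp⟩

/-- The translate `g · iC_n`. -/
def giC {n : ℕ} (g : Sp n ℤ) : Set (Siegel n) := {Z | ∃ Y : Cone n, Z = g • iMul Y}

/-! ### The locally symmetric spaces -/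

/-- `X = Γ(N) \ 𝔥_n`, with the quotient topology. -/
abbrev X (n N : ℕ) : Type := Quotient (MulAction.orbitRel (Gam n N) (Siegel n))

/-- The projection `𝔥_n → X`. -/
noncomputable def X.mk {n : ℕ} (N : ℕ) (Z : Siegel n) : X n N := Quotient.mk _ Z

lemma tau_mem_Gam {n N : ℕ} {g : Sp n ℤ} (h : g ∈ Gam n N) : tau g ∈ Gam n N := by
  rw [Gam, MonoidHom.mem_ker] at h ⊢
  rw [← tau_spMap, h, map_one]

/-- The involution of `X` induced by `τ`. -/
noncomputable def X.tau {n N : ℕ} : X n N → X n N :=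
  Quotient.map tauS fun Z W h => by
    obtain ⟨γ, rfl⟩ := h
    refine ⟨⟨SiegelReal.tau γ.1, tau_mem_Gam γ.2⟩, ?_⟩
    change toReal n (SiegelReal.tau γ.1) • tauS W = tauS (toReal n γ.1 • W)
    rw [tauS_smul, toReal, tau_spMap]

/-- The set `X_ℝ` of `τ`-real points of `X`. -/
def realPts (n N : ℕ) : Set (X n N) := {x | X.tau x = x}

/-- The locus `𝔥_n^γ` of `γ`-real points. -/
def gammaReal {n : ℕ} (γ : Sp n ℝ) : Set (Siegel n) := {Z | γ • Z = tauS Z}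

/-- `Γ_ℓ(N) \ C_n`, with the quotient topology. -/
abbrev ConeQuot (n N : ℕ) : Type := Quotient (MulAction.orbitRel (GamL n N) (Cone n))

/-- The subgroup `ᵍΓ_ℓ(N) = g Γ_ℓ(N) g⁻¹` of `Sp(2n, ℤ)`. -/
def conjGamL {n : ℕ} (N : ℕ) (g : Sp n ℤ) : Subgroup (Sp n ℤ) :=
  (GamLSp n N).map (MulAut.conj g).toMonoidHom

/-- `ᵍΓ_ℓ(N) \ g·iC_n`, with the quotient topology: two points of `g·iC_n` are identified when
an element of `ᵍΓ_ℓ(N)` carries one to the other. -/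
abbrev Piece {n : ℕ} (N : ℕ) (g : Sp n ℤ) : Type :=
  Quotient ((MulAction.orbitRel (conjGamL N g) (Siegel n)).comap (Subtype.val : giC g → Siegel n))

/-! ### Nonabelian cohomology -/

/-- The 1-cocycles of a group `G` acting by `ρ` on a (not necessarily commutative) group `A`. -/
structure Cocycle {G A : Type} [Group G] [Group A] (ρ : G →* MulAut A) where
  toFun : G → A
  cocycle : ∀ s t, toFun (s * t) = ρ s (toFun t) * toFun s

/-- Two cocycles `f`, `f'` are cohomologous if `f'(s) = s(h) f(s) h⁻¹` for some `h`. -/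
def cohomologous {G A : Type} [Group G] [Group A] (ρ : G →* MulAut A) : Setoid (Cocycle ρ) where
  r f f' := ∃ h : A, ∀ s, f'.toFun s = ρ s h * f.toFun s * h⁻¹
  iseqv := by
    refine ⟨fun f => ⟨1, by simp⟩, ?_, ?_⟩
    · rintro f f' ⟨h, hh⟩
      refine ⟨h⁻¹, fun s => ?_⟩
      rw [hh, map_inv]
      group
    · rintro f f' f'' ⟨h, hh⟩ ⟨k, hk⟩
      refine ⟨k * h, fun s => ?_⟩
      rw [hk, hh, map_mul]
      group

/-- The first cohomology set `H¹(G, A)`. -/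
abbrev H1 {G A : Type} [Group G] [Group A] (ρ : G →* MulAut A) : Type :=
  Quotient (cohomologous ρ)

/-- `τ` as an automorphism of `Γ(N)`. -/
def tauGam (n N : ℕ) : MulAut (Gam n N) where
  toFun γ := ⟨tau γ.1, tau_mem_Gam γ.2⟩
  invFun γ := ⟨tau γ.1, tau_mem_Gam γ.2⟩
  left_inv γ := Subtype.ext (tau_tau γ.1)
  right_inv γ := Subtype.ext (tau_tau γ.1)
  map_mul' γ δ := Subtype.ext (map_mul tau γ.1 δ.1)

open Classical in
/-- The action of `Gal(ℂ/ℝ)` on `Γ(N)`, in which complex conjugation acts by `τ`. -/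
noncomputable def galAction (n N : ℕ) : (ℂ ≃ₐ[ℝ] ℂ) →* MulAut (Gam n N) where
  toFun σ := if σ = 1 then 1 else tauGam n N
  map_one' := by simp
  map_mul' σ σ' := by
    have h : ∀ σ : ℂ ≃ₐ[ℝ] ℂ, σ = 1 ∨ σ = Complex.conjAe := fun σ => by
      rcases Complex.real_algHom_eq_id_or_conj σ.toAlgHom with h | h
      · exact Or.inl (AlgEquiv.ext fun z => DFunLike.congr_fun h z)
      · exact Or.inr (AlgEquiv.ext fun z => DFunLike.congr_fun h z)
    have hne : Complex.conjAe ≠ 1 := fun h => by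
      have := congrArg Complex.im (DFunLike.congr_fun h Complex.I)
      norm_num at this
    have hc : Complex.conjAe * Complex.conjAe = 1 := AlgEquiv.ext fun z => Complex.conj_conj z
    have ht : tauGam n N * tauGam n N = 1 :=
      MulEquiv.ext fun γ => Subtype.ext (tau_tau γ.1)
    rcases h σ with rfl | rfl <;> rcases h σ' with rfl | rfl <;> simp [hne, hc, ht]

/-- `H¹(ℂ/ℝ, Γ(N))`. -/
abbrev GalH1 (n N : ℕ) : Type := H1 (galAction n N)

/-! ### The index set -/

/-- The double coset space `Γ(4m) \ Γ_{2m}(2) / Γ_ℓ(2)`. -/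
abbrev Index (n m : ℕ) : Type :=
  DoubleCoset.Quotient ((Gam n (4 * m)).subgroupOf (Gam2 n m) : Set (Gam2 n m))
    ((GamLSp n 2).subgroupOf (Gam2 n m) : Set (Gam2 n m))

/-- The double coset of `g`. -/
def Index.mk {n m : ℕ} (g : Gam2 n m) : Index n m :=
  DoubleCoset.mk ((Gam n (4 * m)).subgroupOf (Gam2 n m)) ((GamLSp n 2).subgroupOf (Gam2 n m)) g

end SiegelReal

open SiegelReal

namespace SiegelReal

open Matrix

/-! ### Congruences between symplectic matrices -/

/-! A point of `X` represented by `Z` is real exactly when some `γ ∈ Γ(4m)` carries `Z` to `τ(Z)`.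
Stabilizers in `Sp(2n, ℤ)` are finite and `Γ(4m)` is torsion-free, so `Γ(4m)` acts freely
(`eq_one_of_smul_eq`). Hence `γ` is determined by `Z`, and `τ(γ)γ`, which fixes `Z`, is `1`: `γ` is
a cocycle.

The arithmetic core is `exists_mem_Gam2_tau_mul_inv`: such a `γ` has the form `τ(g)g⁻¹` with `g ∈
Γ_{2m}(2)`. Indeed `I₋γ` is an antisymplectic involution congruent to `1` modulo `2`, so `ℤ²ⁿ` is
the direct sum of its two eigenlattices. These are isotropic and in perfect duality, and a
symplectic basis adapted to them conjugates `I₋γ` to `I₋`. The congruence `τ(g) ≡ g` modulo `4m`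
controls the off-diagonal blocks of `g`, and a factor from `GL(n, ℤ)` corrects the diagonal ones.

The rest is bookkeeping with `τ`. The fixed points of `τ` are `iC_n` in `𝔥_n` and `GL(n, ℤ)` in
`Sp(2n, ℤ)`. Translating by `g`, the `γ`-real locus is `g·iC_n` (`mem_giC_iff`), and `g` is unique
up to `GL(n, ℤ)` on the right (`exists_eq_mul_glEmb`). So cohomology classes match double cosets,
and by freeness translates of the cone that meet modulo `Γ(4m)` have the same double coset. The
resulting continuous bijection is open because the action is discontinuous (`isOpenMap_pieceMap`).
-/

lemma fromBlocks_sub_fromBlocks {n : ℕ} {R : Type} [CommRing R]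
    (A B C D A' B' C' D' : Matrix (Fin n) (Fin n) R) :
    fromBlocks A B C D - fromBlocks A' B' C' D'
      = fromBlocks (A - A') (B - B') (C - C') (D - D') := by
  rw [sub_eq_add_neg, fromBlocks_neg, fromBlocks_add]
  simp only [← sub_eq_add_neg]

lemma eq_zero_of_neg_eq_self {k l : Type*} {M : Matrix k l ℤ} (h : -M = M) : M = 0 := by
  ext i j
  have := congrFun (congrFun h i) j
  simp only [Matrix.neg_apply] at this
  simp only [Matrix.zero_apply]
  omega

lemma coe_tau {n : ℕ} {R : Type} [CommRing R] (g : Sp n R) :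
    (tau g).1 = fromBlocks g.1.toBlocks₁₁ (-g.1.toBlocks₁₂) (-g.1.toBlocks₂₁) g.1.toBlocks₂₂ := by
  change Iminus n R * g.1 * Iminus n R = _
  conv_lhs => rw [← fromBlocks_toBlocks g.1]
  simp [Iminus, fromBlocks_multiply]

lemma blocks_mem {n : ℕ} {R : Type} [CommRing R] (g : Sp n R) :
    g.1.toBlocks₁₁ᵀ * g.1.toBlocks₂₁ = g.1.toBlocks₂₁ᵀ * g.1.toBlocks₁₁ ∧
    g.1.toBlocks₁₂ᵀ * g.1.toBlocks₂₂ = g.1.toBlocks₂₂ᵀ * g.1.toBlocks₁₂ ∧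
    g.1.toBlocks₁₁ᵀ * g.1.toBlocks₂₂ - g.1.toBlocks₂₁ᵀ * g.1.toBlocks₁₂ = 1 := by
  have h := g.2
  rw [← fromBlocks_toBlocks g.1] at h
  exact SymplecticGroup.fromBlocks_mem_iff.1 h

lemma spMap_eq_iff {n N : ℕ} {g h : Sp n ℤ} :
    spMap n (Int.castRingHom (ZMod N)) g = spMap n (Int.castRingHom (ZMod N)) h ↔
      ∀ i j, (N : ℤ) ∣ (g.1 - h.1) i j := by
  rw [Subtype.ext_iff, ← Matrix.ext_iff]
  refine forall₂_congr fun i j => ?_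
  change ((g.1 i j : ℤ) : ZMod N) = ((h.1 i j : ℤ) : ZMod N) ↔ _
  rw [eq_comm, ZMod.intCast_eq_intCast_iff_dvd_sub, Matrix.sub_apply]

lemma mem_Gam_iff {n N : ℕ} {g : Sp n ℤ} :
    g ∈ Gam n N ↔ ∀ i j, (N : ℤ) ∣ (g.1 - 1) i j := by
  rw [Gam, MonoidHom.mem_ker, ← map_one (spMap n (Int.castRingHom (ZMod N))), spMap_eq_iff]
  rfl

lemma mul_inv_mem_Gam_iff {n N : ℕ} {g h : Sp n ℤ} :
    g * h⁻¹ ∈ Gam n N ↔ ∀ i j, (N : ℤ) ∣ (g.1 - h.1) i j := by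
  rw [Gam, MonoidHom.mem_ker, map_mul, map_inv, mul_inv_eq_one, spMap_eq_iff]

instance Gam_normal (n N : ℕ) : (Gam n N).Normal := MonoidHom.normal_ker _

lemma mem_GamL_iff {n N : ℕ} {A : GL (Fin n) ℤ} :
    A ∈ GamL n N ↔ ∀ i j, (N : ℤ) ∣ (A.1 - 1) i j := by
  rw [GamL, MonoidHom.mem_ker, Units.ext_iff, ← Matrix.ext_iff]
  refine forall₂_congr fun i j => ?_
  have h : (1 : Matrix (Fin n) (Fin n) (ZMod N)) i j
      = (((1 : Matrix (Fin n) (Fin n) ℤ) i j : ℤ) : ZMod N) := by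
    by_cases hij : i = j <;> simp [Matrix.one_apply, hij]
  change ((A.1 i j : ℤ) : ZMod N) = (1 : Matrix (Fin n) (Fin n) (ZMod N)) i j ↔ _
  rw [h, eq_comm, ZMod.intCast_eq_intCast_iff_dvd_sub, Matrix.sub_apply]

lemma coe_glEmb {n : ℕ} {R : Type} [CommRing R] (A : GL (Fin n) R) :
    (glEmb n R A).1 = fromBlocks A.1 0 0 (A⁻¹).1ᵀ := rfl

lemma tau_glEmb {n : ℕ} {R : Type} [CommRing R] (A : GL (Fin n) R) :
    tau (glEmb n R A) = glEmb n R A := by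
  apply Subtype.ext
  rw [coe_tau, coe_glEmb]
  simp

lemma forall_dvd_fromBlocks {n : ℕ} {d : ℤ} {A B C D : Matrix (Fin n) (Fin n) ℤ} :
    (∀ i j, d ∣ fromBlocks A B C D i j) ↔
      (∀ i j, d ∣ A i j) ∧ (∀ i j, d ∣ B i j) ∧ (∀ i j, d ∣ C i j) ∧ (∀ i j, d ∣ D i j) := by
  constructor
  · intro h
    exact ⟨fun i j => h (Sum.inl i) (Sum.inl j), fun i j => h (Sum.inl i) (Sum.inr j),
      fun i j => h (Sum.inr i) (Sum.inl j), fun i j => h (Sum.inr i) (Sum.inr j)⟩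
  · rintro ⟨h1, h2, h3, h4⟩ (i | i) (j | j)
    exacts [h1 i j, h2 i j, h3 i j, h4 i j]

lemma glEmb_mem_Gam_iff {n N : ℕ} {A : GL (Fin n) ℤ} :
    glEmb n ℤ A ∈ Gam n N ↔ A ∈ GamL n N := by
  refine ⟨fun h => mem_GamL_iff.2 fun i j => ?_, fun h => ?_⟩
  · have := mem_Gam_iff.1 h (Sum.inl i) (Sum.inl j)
    rw [coe_glEmb, ← fromBlocks_one, fromBlocks_sub_fromBlocks] at this
    exact this
  · have h' := inv_mem h
    rw [mem_GamL_iff] at h h'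
    rw [mem_Gam_iff, coe_glEmb, ← fromBlocks_one, fromBlocks_sub_fromBlocks, forall_dvd_fromBlocks]
    refine ⟨h, by simp, by simp, fun i j => ?_⟩
    have := h' j i
    simpa [Matrix.one_apply, eq_comm] using this

/-- The off-diagonal blocks vanish, so only the level `2` condition survives. This is why `Γ_ℓ(2)`
is the group on the right of the double cosets. -/
lemma glEmb_mem_Gam2_iff {n m : ℕ} {A : GL (Fin n) ℤ} :
    glEmb n ℤ A ∈ Gam2 n m ↔ A ∈ GamL n 2 := by
  refine ⟨fun h => mem_GamL_iff.2 fun i j => ?_, fun h => ?_⟩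
  · have := h.1 i j
    rwa [coe_glEmb, toBlocks_fromBlocks₁₁] at this
  · have h' := glEmb_mem_Gam_iff.2 h
    rw [mem_Gam_iff, coe_glEmb, ← fromBlocks_one, fromBlocks_sub_fromBlocks,
      forall_dvd_fromBlocks] at h'
    refine ⟨?_, ?_, ?_, ?_⟩ <;> rw [coe_glEmb]
    · rw [toBlocks_fromBlocks₁₁]
      exact h'.1
    · rw [toBlocks_fromBlocks₂₂]
      exact h'.2.2.2
    · simp
    · simp

lemma Gam_le_Gam2 (n m : ℕ) : Gam n (4 * m) ≤ Gam2 n m := by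
  intro g hg
  rw [mem_Gam_iff, ← fromBlocks_toBlocks g.1, ← fromBlocks_one, fromBlocks_sub_fromBlocks,
    forall_dvd_fromBlocks] at hg
  obtain ⟨h1, h2, h3, h4⟩ := hg
  have d1 : (2 : ℤ) ∣ ((4 * m : ℕ) : ℤ) := ⟨2 * m, by push_cast; ring⟩
  have d2 : (2 * m : ℤ) ∣ ((4 * m : ℕ) : ℤ) := ⟨2, by push_cast; ring⟩
  refine ⟨fun i j => d1.trans (h1 i j), fun i j => d1.trans (h4 i j), fun i j => d2.trans ?_,
    fun i j => d2.trans ?_⟩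
  · simpa using h2 i j
  · simpa using h3 i j

/-- `τ(g) ≡ g` modulo `4m` means that the off-diagonal blocks of `g` vanish modulo `2m`. -/
lemma tau_mul_inv_mem_Gam_iff {n m : ℕ} {g : Sp n ℤ} :
    tau g * g⁻¹ ∈ Gam n (4 * m) ↔
      (∀ i j, (2 * m : ℤ) ∣ g.1.toBlocks₁₂ i j) ∧ (∀ i j, (2 * m : ℤ) ∣ g.1.toBlocks₂₁ i j) := by
  -- Passing from `g` to `τ(g)` changes an off-diagonal entry `x` by `-2x`, which turns the level
  -- `4m` into `2m`.
  have key : ∀ x : ℤ, ((4 * m : ℕ) : ℤ) ∣ -x - x ↔ (2 * m : ℤ) ∣ x := fun x => by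
    have e : -x - x = 2 * -x := by ring
    have e' : ((4 * m : ℕ) : ℤ) = 2 * (2 * m) := by push_cast; ring
    rw [e, e', mul_dvd_mul_iff_left two_ne_zero, dvd_neg]
  have e : (tau g).1 - g.1 = fromBlocks 0 (-g.1.toBlocks₁₂ - g.1.toBlocks₁₂)
      (-g.1.toBlocks₂₁ - g.1.toBlocks₂₁) 0 := by
    rw [coe_tau]
    conv_lhs => enter [2]; rw [← fromBlocks_toBlocks g.1]
    rw [fromBlocks_sub_fromBlocks, sub_self, sub_self]
  rw [mul_inv_mem_Gam_iff, e, forall_dvd_fromBlocks]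
  simp only [Matrix.sub_apply, Matrix.neg_apply, key]
  simp

lemma tau_mul_inv_mem_Gam {n m : ℕ} {g : Sp n ℤ} (hg : g ∈ Gam2 n m) :
    tau g * g⁻¹ ∈ Gam n (4 * m) :=
  tau_mul_inv_mem_Gam_iff.2 hg.2.2

/-- The `τ`-fixed elements of `Sp(2n, ℤ)` are those of `GL(n, ℤ)`. -/
lemma exists_glEmb_eq_of_tau_eq {n : ℕ} {g : Sp n ℤ} (h : tau g = g) :
    ∃ A, glEmb n ℤ A = g := by
  have h' := congrArg Subtype.val h
  rw [coe_tau] at h'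
  have h12 : g.1.toBlocks₁₂ = 0 := by
    have := congrArg toBlocks₁₂ h'
    rw [toBlocks_fromBlocks₁₂] at this
    exact eq_zero_of_neg_eq_self this
  have h21 : g.1.toBlocks₂₁ = 0 := by
    have := congrArg toBlocks₂₁ h'
    rw [toBlocks_fromBlocks₂₁] at this
    exact eq_zero_of_neg_eq_self this
  have h1 := (blocks_mem g).2.2
  rw [h12, Matrix.mul_zero, sub_zero] at h1
  have h2 : g.1.toBlocks₂₂ᵀ * g.1.toBlocks₁₁ = 1 := by
    simpa using congrArg Matrix.transpose h1
  refine ⟨⟨g.1.toBlocks₁₁, g.1.toBlocks₂₂ᵀ, mul_eq_one_comm.1 h2, h2⟩, Subtype.ext ?_⟩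
  rw [coe_glEmb]
  conv_rhs => rw [← fromBlocks_toBlocks g.1, h12, h21]
  rw [Units.inv_mk]
  simp

/-! ### Lifting invertible matrices from `𝔽₂` to `ℤ` -/

/-- Any lift of the coefficient `c` to `ℤ` gives a transvection, which is again invertible. -/
lemma exists_GL_map_eq_transvection {n : ℕ} (t : TransvectionStruct (Fin n) (ZMod 2)) :
    ∃ U : GL (Fin n) ℤ, U.1.map (Int.castRingHom (ZMod 2)) = t.toMatrix := by
  obtain ⟨i, j, hij, c⟩ := t
  let t' : TransvectionStruct (Fin n) ℤ := ⟨i, j, hij, (c.val : ℤ)⟩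
  refine ⟨⟨t'.toMatrix, t'.inv.toMatrix, t'.mul_inv, t'.inv_mul⟩, ?_⟩
  ext a b
  simp [t', transvection, Matrix.one_apply, Matrix.single_apply, apply_ite (Int.cast : ℤ → ZMod 2)]

lemma exists_GL_map_eq_list_prod {n : ℕ} (L : List (TransvectionStruct (Fin n) (ZMod 2))) :
    ∃ U : GL (Fin n) ℤ, U.1.map (Int.castRingHom (ZMod 2))
      = (L.map TransvectionStruct.toMatrix).prod := by
  induction L with
  | nil => exact ⟨1, by simp [Matrix.map_one]⟩
  | cons t L ih =>
    obtain ⟨U, hU⟩ := ih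
    obtain ⟨V, hV⟩ := exists_GL_map_eq_transvection t
    exact ⟨V * U, by rw [Units.val_mul, Matrix.map_mul, hU, hV, List.map_cons, List.prod_cons]⟩

/-- `GL(n, ℤ) → GL(n, 𝔽₂)` is surjective. -/
lemma exists_GL_map_eq {n : ℕ} {A : Matrix (Fin n) (Fin n) (ZMod 2)} (hA : IsUnit A.det) :
    ∃ U : GL (Fin n) ℤ, U.1.map (Int.castRingHom (ZMod 2)) = A := by
  have key : ∀ x : ZMod 2, x ≠ 0 → x = 1 := by decide
  have : Fact (Nat.Prime 2) := ⟨Nat.prime_two⟩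
  obtain ⟨L, L', D, h⟩ := Pivot.exists_list_transvec_mul_diagonal_mul_list_transvec A
  obtain ⟨U, hU⟩ := exists_GL_map_eq_list_prod L
  obtain ⟨V, hV⟩ := exists_GL_map_eq_list_prod L'
  -- The only unit of `𝔽₂` is `1`, so the diagonal factor disappears and only transvections need
  -- lifting.
  have hD : D = 1 := by
    have h0 : ∏ i, D i ≠ 0 := by
      intro h0
      rw [h, det_mul, det_mul, det_diagonal, h0] at hA
      simp at hA
    funext i
    exact key _ (Finset.prod_ne_zero_iff.1 h0 i (Finset.mem_univ i))
  refine ⟨U * V, ?_⟩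
  rw [Units.val_mul, Matrix.map_mul, hU, hV, h, hD]
  simp

/-! ### Antisymplectic involutions -/

/-- The eigenvectors of an integral involution that is the identity modulo `2` span. -/
lemma exists_eigenbasis {ι : Type} [Fintype ι] [DecidableEq ι] {s : Matrix ι ι ℤ} (hs : s * s = 1)
    (h2 : ∀ i j, (2 : ℤ) ∣ (s - 1) i j) :
    ∃ (k l : ℕ) (P : Matrix ι (Fin k ⊕ Fin l) ℤ) (P' : Matrix (Fin k ⊕ Fin l) ι ℤ),
      P * P' = 1 ∧ P' * P = 1 ∧
        s * P = P * (fromBlocks (-1) 0 0 1 : Matrix (Fin k ⊕ Fin l) (Fin k ⊕ Fin l) ℤ) := by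
  choose t ht using h2
  -- Writing `s = 1 - 2q`, the relation `s² = 1` becomes `q² = q`. The range and kernel of `q` are
  -- the `-1` and `+1` eigenlattices, and an idempotent splits the whole lattice, with no index `2`
  -- defect.
  let q : Matrix ι ι ℤ := -(Matrix.of t)
  have hsq : s = 1 - (2 : ℤ) • q := by
    ext i j
    have := ht i j
    simp only [Matrix.sub_apply, Matrix.smul_apply, q, Matrix.neg_apply, Matrix.of_apply,
      smul_eq_mul] at this ⊢
    linarith
  have hq : q * q = q := by
    have e : (4 : ℤ) • (q * q) = (4 : ℤ) • q := by
      have : (1 - (2 : ℤ) • q) * (1 - (2 : ℤ) • q) - 1 = (4 : ℤ) • (q * q) - (4 : ℤ) • q := by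
        noncomm_ring
      rw [← hsq, hs, sub_self] at this
      exact (sub_eq_zero.1 this.symm)
    ext i j
    have := congrFun (congrFun e i) j
    simp only [Matrix.smul_apply, smul_eq_mul] at this
    linarith
  have hf : IsIdempotentElem (Matrix.toLin' q) := by
    change Matrix.toLin' q * Matrix.toLin' q = _
    rw [Module.End.mul_eq_comp, ← Matrix.toLin'_mul, hq]
  -- Both summands are free, being submodules of a free `ℤ`-module of finite rank.
  obtain ⟨k, b₁⟩ := Submodule.basisOfPid (Pi.basisFun ℤ ι) (LinearMap.range (Matrix.toLin' q))
  obtain ⟨l, b₂⟩ := Submodule.basisOfPid (Pi.basisFun ℤ ι) (LinearMap.ker (Matrix.toLin' q))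
  let b : Module.Basis (Fin k ⊕ Fin l) ℤ (ι → ℤ) :=
    (b₁.prod b₂).map (Submodule.prodEquivOfIsCompl _ _ (LinearMap.IsIdempotentElem.isCompl hf))
  have hb₁ : ∀ i, q *ᵥ b (Sum.inl i) = b (Sum.inl i) := fun i => by
    have := (LinearMap.IsIdempotentElem.mem_range_iff hf).1 (b₁ i).2
    rw [Matrix.toLin'_apply] at this
    simpa [b] using this
  have hb₂ : ∀ i, q *ᵥ b (Sum.inr i) = 0 := fun i => by
    have := LinearMap.mem_ker.1 (b₂ i).2
    rw [Matrix.toLin'_apply] at this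
    have e : b (Sum.inr i) = (b₂ i : ι → ℤ) := by simp [b]
    rw [e, this]
  refine ⟨k, l, (Pi.basisFun ℤ ι).toMatrix b, b.toMatrix (Pi.basisFun ℤ ι),
    Module.Basis.toMatrix_mul_toMatrix_flip _ _, Module.Basis.toMatrix_mul_toMatrix_flip _ _, ?_⟩
  have hcol : ∀ j, (fun i => (Pi.basisFun ℤ ι).toMatrix b i j) = b j := fun j => by
    funext i
    simp [Module.Basis.toMatrix_apply]
  have hsb : ∀ j, (fun i => (s * (Pi.basisFun ℤ ι).toMatrix b) i j) = b j - (2 : ℤ) • q *ᵥ b j :=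
    fun j => by
      have : (fun i => (s * (Pi.basisFun ℤ ι).toMatrix b) i j) = s *ᵥ b j := by
        rw [← hcol j]
        rfl
      rw [this, hsq, sub_mulVec, one_mulVec, smul_mulVec]
  ext i j
  have h1 := congrFun (hsb j) i
  have h3 : ∀ j, (Pi.basisFun ℤ ι).toMatrix b i j = b j i := fun j => congrFun (hcol j) i
  beta_reduce at h1
  rw [h1, Matrix.mul_apply]
  rcases j with j | j
  · simp [hb₁, h3, Matrix.one_apply]
    ring
  · simp [hb₂, h3, Matrix.one_apply]

/-- An antisymplectic integral involution that is the identity modulo `2` is conjugate to `I₋`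
under `Sp(2n, ℤ)`. -/
lemma exists_conj_Iminus {n : ℕ} {s : Matrix (Fin n ⊕ Fin n) (Fin n ⊕ Fin n) ℤ}
    (hs : s * s = 1) (h2 : ∀ i j, (2 : ℤ) ∣ (s - 1) i j)
    (hJ : sᵀ * J (Fin n) ℤ * s = -J (Fin n) ℤ) :
    ∃ g : Sp n ℤ, s * g.1 = g.1 * Iminus n ℤ := by
  obtain ⟨k, l, P, P', hP, hP', hsP⟩ := exists_eigenbasis hs h2
  set E : Matrix (Fin k ⊕ Fin l) (Fin k ⊕ Fin l) ℤ := fromBlocks (-1) 0 0 1 with hE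
  -- `G` is the Gram matrix of the symplectic form in the eigenbasis, and `H` is its inverse.
  set G := Pᵀ * J (Fin n) ℤ * P with hG
  set H := P' * -J (Fin n) ℤ * P'ᵀ with hH
  have hPt : P'ᵀ * Pᵀ = 1 := by rw [← transpose_mul, hP, transpose_one]
  have hPt' : Pᵀ * P'ᵀ = 1 := by rw [← transpose_mul, hP', transpose_one]
  have hJJ : J (Fin n) ℤ * J (Fin n) ℤ = -1 := J_squared _ _
  have hGH : G * H = 1 := by
    calc G * H = Pᵀ * J (Fin n) ℤ * (P * P') * -J (Fin n) ℤ * P'ᵀ := by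
          simp only [hG, hH, Matrix.mul_assoc]
      _ = Pᵀ * -(J (Fin n) ℤ * J (Fin n) ℤ) * P'ᵀ := by
          rw [hP]
          simp only [Matrix.mul_assoc, Matrix.one_mul, Matrix.neg_mul, Matrix.mul_neg]
      _ = 1 := by rw [hJJ, neg_neg, Matrix.mul_one, hPt']
  have hHG : H * G = 1 := mul_eq_one_comm.1 hGH
  have hGt : Gᵀ = -G := by
    rw [hG, transpose_mul, transpose_mul, transpose_transpose, J_transpose]
    simp only [Matrix.mul_assoc, Matrix.neg_mul, Matrix.mul_neg]
  have hEt : Eᵀ = E := by simp [hE, fromBlocks_transpose]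
  have hEG : E * G * E = -G := by
    calc E * G * E = (P * E)ᵀ * J (Fin n) ℤ * (P * E) := by
          rw [transpose_mul, hEt]
          simp only [hG, Matrix.mul_assoc]
      _ = Pᵀ * (sᵀ * J (Fin n) ℤ * s) * P := by
          rw [← hsP, transpose_mul]
          simp only [Matrix.mul_assoc]
      _ = -G := by rw [hJ, Matrix.mul_neg, Matrix.neg_mul, hG]
  obtain ⟨G₁, M, K, G₂, hGb⟩ : ∃ G₁ M K G₂, G = fromBlocks G₁ M K G₂ :=
    ⟨_, _, _, _, (fromBlocks_toBlocks G).symm⟩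
  obtain ⟨H₁, H₂, H₃, H₄, hHb⟩ : ∃ H₁ H₂ H₃ H₄, H = fromBlocks H₁ H₂ H₃ H₄ :=
    ⟨_, _, _, _, (fromBlocks_toBlocks H).symm⟩
  rw [hGb, hE, fromBlocks_multiply, fromBlocks_multiply, fromBlocks_neg, fromBlocks_inj] at hEG
  rw [hGb, fromBlocks_transpose, fromBlocks_neg, fromBlocks_inj] at hGt
  -- `E G E = -G` leaves the diagonal blocks of `G` unchanged on the left and negates them on the
  -- right: both eigenlattices are isotropic.
  have hG₁ : G₁ = 0 := eq_zero_of_neg_eq_self (by simpa using hEG.1.symm)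
  have hG₂ : G₂ = 0 := eq_zero_of_neg_eq_self (by simpa using hEG.2.2.2.symm)
  rw [hGb, hHb, fromBlocks_multiply, ← fromBlocks_one, fromBlocks_inj, hG₁, hG₂] at hGH
  rw [hGb, hHb, fromBlocks_multiply, ← fromBlocks_one, fromBlocks_inj, hG₁, hG₂] at hHG
  have hMH : M * H₃ = 1 := by simpa using hGH.1
  have hHM : H₃ * M = 1 := by simpa using hHG.2.2.2
  -- The off-diagonal block `M` is invertible, so the eigenlattices have equal rank, which must be
  -- `n`.
  have hkl : k = l := by simpa using Matrix.square_of_invertible M H₃ hMH hHM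
  have hkn : n + n = k + l := by simpa using Matrix.square_of_invertible P P' hP hP'
  obtain rfl : k = l := hkl
  obtain rfl : n = k := by omega
  have hK : K = -Mᵀ := by rw [hGt.2.2.1, neg_neg]
  -- Changing the basis of the `+1` eigenlattice alone keeps all columns eigenvectors. The factor
  -- `-H₃ = -M⁻¹` turns the upper right block of the Gram matrix into `-1`, as in `J`.
  refine ⟨⟨P * fromBlocks 1 0 0 (-H₃), ?_⟩, ?_⟩
  · rw [SymplecticGroup.mem_iff', transpose_mul]
    calc (fromBlocks 1 0 0 (-H₃))ᵀ * Pᵀ * J (Fin n) ℤ * (P * fromBlocks 1 0 0 (-H₃))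
        = (fromBlocks 1 0 0 (-H₃))ᵀ * G * fromBlocks 1 0 0 (-H₃) := by
          simp only [hG, Matrix.mul_assoc]
      _ = J (Fin n) ℤ := by
          rw [hGb, hG₁, hG₂, hK, fromBlocks_transpose, fromBlocks_multiply, fromBlocks_multiply, J]
          simp [← transpose_mul, hMH]
  · change s * (P * fromBlocks 1 0 0 (-H₃)) = P * fromBlocks 1 0 0 (-H₃) * Iminus n ℤ
    rw [← Matrix.mul_assoc, hsP, Matrix.mul_assoc, Matrix.mul_assoc, hE, Iminus,
      fromBlocks_multiply, fromBlocks_multiply]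
    simp

/-! ### Triviality of cocycles in `Γ_{2m}(2)` -/

/-- Put `s = I₋γ`. The cocycle relation says `s² = 1`, and `s g = g I₋` is equivalent to `γ g = I₋ g
I₋ = τ(g)`. Since `I₋ ≡ 1` modulo `2`, an even level is enough to make `s ≡ 1` modulo `2`. -/
lemma exists_tau_eq_mul {n N : ℕ} (hN : 2 ∣ N) {γ : Sp n ℤ} (hγ : γ ∈ Gam n N)
    (hc : tau γ * γ = 1) : ∃ g : Sp n ℤ, tau g = γ * g := by
  have hI := Iminus_mul_self n ℤ
  have hval : Iminus n ℤ * γ.1 * Iminus n ℤ * γ.1 = 1 := congrArg Subtype.val hc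
  have hIJ : (Iminus n ℤ)ᵀ * J (Fin n) ℤ * Iminus n ℤ = -J (Fin n) ℤ := by
    simp [Iminus, J, fromBlocks_transpose, fromBlocks_multiply, fromBlocks_neg]
  have h2 : ∀ i j, (2 : ℤ) ∣ (Iminus n ℤ * γ.1 - 1) i j := by
    intro i j
    have e : Iminus n ℤ * γ.1 - 1 = Iminus n ℤ * (γ.1 - 1) + (Iminus n ℤ - 1) := by
      noncomm_ring
    have hN' : (2 : ℤ) ∣ N := by exact_mod_cast hN
    rw [e, Matrix.add_apply]
    refine dvd_add ?_ ?_
    · rw [Matrix.mul_apply]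
      exact Finset.dvd_sum fun k _ => (hN'.trans (mem_Gam_iff.1 hγ k j)).mul_left _
    · revert i j
      rw [Iminus, ← fromBlocks_one, fromBlocks_sub_fromBlocks, forall_dvd_fromBlocks]
      refine ⟨fun i j => ⟨-(1 : Matrix (Fin n) (Fin n) ℤ) i j, ?_⟩, by simp, by simp, by simp⟩
      simp only [Matrix.sub_apply, Matrix.neg_apply]
      ring
  have hJ : (Iminus n ℤ * γ.1)ᵀ * J (Fin n) ℤ * (Iminus n ℤ * γ.1) = -J (Fin n) ℤ := by
    have h := SymplecticGroup.mem_iff'.1 γ.2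
    rw [transpose_mul]
    calc γ.1ᵀ * (Iminus n ℤ)ᵀ * J (Fin n) ℤ * (Iminus n ℤ * γ.1)
        = γ.1ᵀ * ((Iminus n ℤ)ᵀ * J (Fin n) ℤ * Iminus n ℤ) * γ.1 := by
          simp only [Matrix.mul_assoc]
      _ = -J (Fin n) ℤ := by rw [hIJ, Matrix.mul_neg, Matrix.neg_mul, h]
  obtain ⟨g, hg⟩ := exists_conj_Iminus (by rw [← Matrix.mul_assoc, hval]) h2 hJ
  refine ⟨g, Subtype.ext ?_⟩
  change Iminus n ℤ * g.1 * Iminus n ℤ = γ.1 * g.1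
  rw [Matrix.mul_assoc, ← hg, ← Matrix.mul_assoc, ← Matrix.mul_assoc, hI, Matrix.one_mul]

/-- Every cocycle in `Γ(4m)` becomes trivial in `Γ_{2m}(2)`. -/
lemma exists_mem_Gam2_tau_mul_inv {n m : ℕ} {γ : Sp n ℤ} (hγ : γ ∈ Gam n (4 * m))
    (hc : tau γ * γ = 1) : ∃ g ∈ Gam2 n m, tau g * g⁻¹ = γ := by
  obtain ⟨g, hg⟩ := exists_tau_eq_mul (N := 4 * m) ⟨2 * m, by ring⟩ hγ hc
  -- The off-diagonal congruences hold for every solution `h`, so only the diagonal blocks need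
  -- adjusting.
  have hmod : ∀ h : Sp n ℤ, tau h * h⁻¹ = γ →
      (∀ i j, (2 * m : ℤ) ∣ h.1.toBlocks₁₂ i j) ∧ (∀ i j, (2 * m : ℤ) ∣ h.1.toBlocks₂₁ i j) :=
    fun h hh => tau_mul_inv_mem_Gam_iff.1 (hh ▸ hγ)
  have hg' : tau g * g⁻¹ = γ := by rw [hg, mul_inv_cancel_right]
  have two : ∀ {x : ℤ}, (2 * m : ℤ) ∣ x → (2 : ℤ) ∣ x := fun hx => (Dvd.intro _ rfl).trans hx
  have hcong : ∀ h : Sp n ℤ, tau h * h⁻¹ = γ →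
      ∀ i j, (2 : ℤ) ∣ (h.1.toBlocks₁₁ᵀ * h.1.toBlocks₂₂ - 1) i j := fun h hh => by
    rw [← (blocks_mem h).2.2, sub_sub_cancel]
    exact dvd_mul_left_mat (fun i j => two ((hmod h hh).1 i j)) _
  -- Modulo `2` the off-diagonal blocks vanish and the symplectic relation reads `ᵗA D ≡ 1`.
  have hunit : IsUnit (g.1.toBlocks₁₁.map (Int.castRingHom (ZMod 2))).det := by
    have e : (g.1.toBlocks₁₁.map (Int.castRingHom (ZMod 2)))ᵀ
        * g.1.toBlocks₂₂.map (Int.castRingHom (ZMod 2)) = 1 := by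
      ext i j
      have := hcong g hg' i j
      rw [Matrix.sub_apply] at this
      have := (ZMod.intCast_eq_intCast_iff_dvd_sub _ _ 2).2 this
      rw [← transpose_map, ← Matrix.map_mul, ← Matrix.map_one (Int.castRingHom (ZMod 2))
        (map_zero _) (map_one _)]
      exact this.symm
    have := congrArg Matrix.det e
    rw [det_mul, det_transpose, det_one] at this
    exact IsUnit.of_mul_eq_one _ this
  obtain ⟨U, hU⟩ := exists_GL_map_eq hunit
  -- Right multiplication by `GL(n, ℤ)`, which `τ` fixes, does not change `τ(g)g⁻¹`.
  have hh : tau (g * glEmb n ℤ U⁻¹) * (g * glEmb n ℤ U⁻¹)⁻¹ = γ := by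
    rw [map_mul, tau_glEmb, ← hg']
    group
  refine ⟨g * glEmb n ℤ U⁻¹, ?_, hh⟩
  have h11 : ∀ i j, (2 : ℤ) ∣ ((g * glEmb n ℤ U⁻¹).1.toBlocks₁₁ - 1) i j := by
    have e : (g * glEmb n ℤ U⁻¹).1.toBlocks₁₁ - 1 = (g.1.toBlocks₁₁ - U.1) * (U⁻¹).1 := by
      rw [Submonoid.coe_mul, (toBlocks_mul _ _).1, coe_glEmb, toBlocks_fromBlocks₁₁,
        toBlocks_fromBlocks₂₁, Matrix.mul_zero, add_zero, Matrix.sub_mul, ← Units.val_mul,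
        mul_inv_cancel, Units.val_one]
    rw [e]
    refine dvd_mul_right_mat (fun i j => ?_) _
    exact (ZMod.intCast_eq_intCast_iff_dvd_sub _ _ 2).1 (congrFun (congrFun hU i) j)
  refine ⟨h11, fun i j => ?_, (hmod _ hh).1, (hmod _ hh).2⟩
  have h1 := hcong _ hh
  set h := g * glEmb n ℤ U⁻¹
  -- With `A ≡ 1` modulo `2`, the relation `ᵗA D ≡ 1` forces `D ≡ 1`.
  have e : h.1.toBlocks₂₂ - 1 = (h.1.toBlocks₁₁ᵀ * h.1.toBlocks₂₂ - 1)
      - (h.1.toBlocks₁₁ - 1)ᵀ * h.1.toBlocks₂₂ := by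
    rw [transpose_sub, transpose_one]
    noncomm_ring
  rw [e, Matrix.sub_apply]
  exact dvd_sub (h1 i j) (dvd_mul_right_mat (fun i j => h11 j i) _ i j)

/-! ### Torsion in principal congruence subgroups -/

/-- The determinant of `N` is odd, hence nonzero, and the adjugate cancels `N` up to this scalar. -/
lemma eq_zero_of_mul_eq_zero_of_odd {ι : Type} [Fintype ι] [DecidableEq ι] {M N : Matrix ι ι ℤ}
    (hN : (Int.castRingHom (ZMod 2)).mapMatrix N = 1) (h : M * N = 0) : M = 0 := by
  have hdet : N.det ≠ 0 := by
    intro h0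
    have := RingHom.map_det (Int.castRingHom (ZMod 2)) N
    rw [h0, hN, det_one, map_zero] at this
    exact zero_ne_one this
  have e : N.det • M = 0 := by
    rw [← Matrix.mul_one M, ← mul_smul_comm, ← mul_adjugate, ← Matrix.mul_assoc, h,
      Matrix.zero_mul]
  exact (smul_eq_zero.1 e).resolve_left hdet

/-- An integral matrix of finite order that is the identity modulo `4` is the identity. -/
lemma eq_one_of_pow_eq_one {ι : Type} [Fintype ι] [DecidableEq ι] {g : Matrix ι ι ℤ}
    (h4 : (Int.castRingHom (ZMod 4)).mapMatrix g = 1) {k : ℕ} (hk : 0 < k) (hg : g ^ k = 1) :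
    g = 1 := by
  have hdvd : ∀ {h : Matrix ι ι ℤ}, (Int.castRingHom (ZMod 4)).mapMatrix h = 1 →
      ∃ t : Matrix ι ι ℤ, h = 1 + (4 : ℤ) • t := by
    intro h hh
    have key : ∀ i j, (4 : ℤ) ∣ (h - 1) i j := fun i j => by
      have e := congrFun (congrFun hh i) j
      rw [← map_one (Int.castRingHom (ZMod 4)).mapMatrix] at e
      exact (ZMod.intCast_eq_intCast_iff_dvd_sub _ _ 4).1 e.symm
    choose t ht using key
    refine ⟨Matrix.of t, ?_⟩
    ext i j
    have := ht i j
    simp only [Matrix.sub_apply, Matrix.add_apply, Matrix.smul_apply, Matrix.of_apply,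
      smul_eq_mul] at this ⊢
    linarith
  have two : (2 : Matrix ι ι (ZMod 2)) = 0 := by
    have : (2 : Matrix ι ι (ZMod 2)) = algebraMap (ZMod 2) _ 2 := (map_ofNat _ 2).symm
    rw [this, show (2 : ZMod 2) = 0 from rfl, map_zero]
  have hodd : ∀ t : Matrix ι ι ℤ, (Int.castRingHom (ZMod 2)).mapMatrix (1 + (2 : ℤ) • t) = 1 := by
    intro t
    rw [map_add, map_one, zsmul_eq_mul, map_mul, map_intCast, Int.cast_ofNat, two, zero_mul,
      add_zero]
  induction k using Nat.strong_induction_on with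
  | _ k ih =>
    rcases Nat.even_or_odd k with ⟨l, rfl⟩ | ⟨l, rfl⟩
    · obtain ⟨t, ht⟩ := hdvd (h := g ^ l) (by rw [map_pow, h4, one_pow])
      refine ih l (by omega) (by omega) (sub_eq_zero.1 ?_)
      refine eq_zero_of_mul_eq_zero_of_odd (hodd t) ?_
      -- From `g ^ l = 1 + 4t` the cofactor `g ^ l + 1` is twice `1 + 2t`, which is the identity
      -- modulo `2` and can be cancelled. This is where level `4` rather than `2` is needed.
      have e : (2 : ℤ) • ((g ^ l - 1) * (1 + (2 : ℤ) • t)) = 0 := by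
        have h1 : (2 : ℤ) • (1 + (2 : ℤ) • t) = g ^ l + 1 := by
          rw [ht]
          module
        rw [← mul_smul_comm, h1]
        have : (g ^ l - 1) * (g ^ l + 1) = g ^ (l + l) - 1 := by
          rw [pow_add]
          noncomm_ring
        rw [this, hg, sub_self]
      exact (smul_eq_zero.1 e).resolve_left two_ne_zero
    · have h2 : (Int.castRingHom (ZMod 2)).mapMatrix g = 1 := by
        obtain ⟨t, rfl⟩ := hdvd h4
        have := hodd ((2 : ℤ) • t)
        rwa [smul_smul] at this
      -- For an odd exponent the geometric sum is a sum of an odd number of matrices congruent to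
      -- `1` modulo `2`, hence itself congruent to `1`.
      refine sub_eq_zero.1 (eq_zero_of_mul_eq_zero_of_odd
        (N := ∑ i ∈ Finset.range (2 * l + 1), g ^ i) ?_ ?_)
      · simp only [map_sum, map_pow, h2, one_pow]
        simp [two]
      · rw [mul_geom_sum, hg, sub_self]

lemma eq_one_of_mem_Gam_of_pow_eq_one {n m : ℕ} {g : Sp n ℤ} (hg : g ∈ Gam n (4 * m)) {k : ℕ}
    (hk : 0 < k) (h : g ^ k = 1) : g = 1 := by
  refine Subtype.ext (eq_one_of_pow_eq_one ?_ hk ?_)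
  · ext i j
    rw [← map_one (Int.castRingHom (ZMod 4)).mapMatrix]
    refine ((ZMod.intCast_eq_intCast_iff_dvd_sub _ _ 4).2 ?_).symm
    exact dvd_trans ⟨(m : ℤ), by push_cast; ring⟩ (mem_Gam_iff.1 hg i j)
  · rw [← SubmonoidClass.coe_pow, h]
    rfl

/-! ### Continuity -/

lemma continuous_num {n : ℕ} (g : Sp n ℝ) : Continuous fun Z : Siegel n => num g Z.1 :=
  (continuous_const.matrix_mul continuous_subtype_val).add continuous_const

lemma continuous_den {n : ℕ} (g : Sp n ℝ) : Continuous fun Z : Siegel n => den g Z.1 :=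
  (continuous_const.matrix_mul continuous_subtype_val).add continuous_const

lemma continuous_matrix_inv {T : Type*} [TopologicalSpace T] {n : ℕ}
    {f : T → Matrix (Fin n) (Fin n) ℂ} (hf : Continuous f) (hu : ∀ t, IsUnit (f t).det) :
    Continuous fun t => (f t)⁻¹ := by
  simp only [Matrix.inv_def, Ring.inverse_eq_inv']
  exact (hf.matrix_det.inv₀ fun t => (hu t).ne_zero).smul hf.matrix_adjugate

instance (n : ℕ) : ContinuousConstSMul (Sp n ℝ) (Siegel n) where
  continuous_const_smul g := Continuous.subtype_mk
    ((continuous_num g).matrix_mul (continuous_matrix_inv (continuous_den g) (isUnit_den g))) _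

instance (n : ℕ) : ContinuousConstSMul (Sp n ℤ) (Siegel n) where
  continuous_const_smul g := continuous_const_smul (toReal n g)

instance (n : ℕ) : T2Space (Siegel n) :=
  inferInstanceAs (T2Space {Z : Matrix (Fin n) (Fin n) ℂ // Zᵀ = Z ∧ (Z.map Complex.im).PosDef})

lemma continuous_tauS {n : ℕ} : Continuous (tauS : Siegel n → Siegel n) :=
  Continuous.subtype_mk (continuous_subtype_val.matrix_map Complex.continuous_conj).neg _

lemma continuous_iMul {n : ℕ} : Continuous (iMul : Cone n → Siegel n) :=
  Continuous.subtype_mk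
    ((continuous_subtype_val.matrix_map Complex.continuous_ofReal).const_smul Complex.I) _

/-- The imaginary part, as a point of the cone. -/
def imPart {n : ℕ} (Z : Siegel n) : Cone n := ⟨Z.1.map Complex.im, Z.2.2⟩

lemma continuous_imPart {n : ℕ} : Continuous (imPart : Siegel n → Cone n) :=
  Continuous.subtype_mk (continuous_subtype_val.matrix_map Complex.continuous_im) _

lemma imPart_iMul {n : ℕ} (Y : Cone n) : imPart (iMul Y) = Y := by
  apply Subtype.ext
  ext i j
  simp [imPart, iMul]

lemma iMul_imPart {n : ℕ} {Z : Siegel n} (h : tauS Z = Z) : iMul (imPart Z) = Z := by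
  apply Subtype.ext
  ext i j
  have := congrFun (congrFun (congrArg Subtype.val h) i) j
  simp only [tauS, Matrix.neg_apply, Matrix.map_apply] at this
  have hre := congrArg Complex.re this
  simp only [Complex.neg_re, Complex.conj_re] at hre
  apply Complex.ext
  · simp [imPart, iMul]
    linarith
  · simp [imPart, iMul]

lemma tauS_iMul {n : ℕ} (Y : Cone n) : tauS (iMul Y) = iMul Y := by
  apply Subtype.ext
  ext i j
  simp [tauS, iMul]

/-! ### Discontinuity of the action of `Sp(2n, ℤ)` -/

section SquareRoot

open scoped ComplexOrder MatrixOrder Matrix.Norms.L2Operator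

/-- Kept in its own section because it uses the C*-algebra norm, whereas the estimates below use the
Frobenius norm. -/
lemma exists_eq_conjTranspose_mul_self {n : ℕ} {M : Matrix (Fin n) (Fin n) ℂ} (h : M.PosSemidef) :
    ∃ S, M = Sᴴ * S :=
  CStarAlgebra.nonneg_iff_eq_star_mul_self.mp h.nonneg

end SquareRoot

/-! ### Bounds for `g` in terms of `Z` and `gZ` -/

section Frobenius

open scoped Matrix.Norms.Frobenius

lemma frobenius_norm_sq {n : ℕ} (M : Matrix (Fin n) (Fin n) ℂ) :
    ‖M‖ ^ 2 = ∑ i, ∑ j, ‖M i j‖ ^ 2 := by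
  rw [frobenius_norm_def, ← Real.sqrt_eq_rpow, Real.sq_sqrt (by positivity)]
  simp

lemma norm_entry_le_frobenius {n : ℕ} (M : Matrix (Fin n) (Fin n) ℂ) (i j : Fin n) :
    ‖M i j‖ ≤ ‖M‖ := by
  refine pow_le_pow_iff_left₀ (norm_nonneg _) (norm_nonneg _) two_ne_zero |>.1 ?_
  rw [frobenius_norm_sq]
  exact (Finset.single_le_sum (f := fun j => ‖M i j‖ ^ 2) (fun _ _ => by positivity)
    (Finset.mem_univ j)).trans (Finset.single_le_sum (f := fun i => ∑ j, ‖M i j‖ ^ 2)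
      (fun _ _ => by positivity) (Finset.mem_univ i))

lemma trace_mul_conjTranspose {n : ℕ} (M : Matrix (Fin n) (Fin n) ℂ) :
    trace (M * Mᴴ) = ((‖M‖ ^ 2 : ℝ) : ℂ) := by
  rw [frobenius_norm_sq]
  simp only [trace, diag, Matrix.mul_apply, conjTranspose_apply, Complex.ofReal_sum]
  refine Finset.sum_congr rfl fun i _ => Finset.sum_congr rfl fun j _ => ?_
  rw [RCLike.star_def, Complex.mul_conj, Complex.normSq_eq_norm_sq]

/-- The imaginary part, as a complex matrix. -/
noncomputable def imC {n : ℕ} (Z : Siegel n) : Matrix (Fin n) (Fin n) ℂ :=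
  (Z.1.map Complex.im).map (algebraMap ℝ ℂ)

open scoped ComplexOrder in
lemma isUnit_imC {n : ℕ} (Z : Siegel n) : IsUnit (imC Z).det :=
  isUnit_iff_ne_zero.2 (posDef_map_complex Z.2.2).det_pos.ne'

lemma continuous_imC {n : ℕ} : Continuous (imC : Siegel n → Matrix (Fin n) (Fin n) ℂ) :=
  (continuous_subtype_val.matrix_map Complex.continuous_im).matrix_map Complex.continuous_ofReal

/-- `Im Z = (CZ + D)ᴴ Im(gZ) (CZ + D)`. -/
lemma den_mul_imC_smul {n : ℕ} (g : Sp n ℝ) (Z : Siegel n) :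
    (den g Z.1)ᴴ * imC (g • Z) * den g Z.1 = imC Z := by
  have h4 : (2 * Complex.I) ≠ 0 := by simp
  have h1 : (g • Z).1 * den g Z.1 = num g Z.1 := by
    rw [coe_smul, Matrix.mul_assoc, nonsing_inv_mul _ (isUnit_den g Z), Matrix.mul_one]
  apply smul_right_injective _ h4
  change (2 * Complex.I) • _ = (2 * Complex.I) • (Z.1.map Complex.im).map (algebraMap ℝ ℂ)
  rw [← sub_conjTranspose Z.2.1, ← herm_rel g, ← h1, conjTranspose_mul, ← Matrix.smul_mul,
    ← Matrix.mul_smul, imC, ← sub_conjTranspose (g • Z).2.1]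
  simp only [Matrix.mul_sub, Matrix.sub_mul, Matrix.mul_assoc]

open scoped ComplexOrder in
-- Write `Im Z = SᴴS` and `Q = CZ + D`. The transformation rule for imaginary parts gives `Im(gZ)⁻¹
-- = (QS⁻¹)(QS⁻¹)ᴴ`, so the traces are `‖S‖²` and `‖QS⁻¹‖²`, and `Q = (QS⁻¹)S`.
lemma norm_den_sq_le {n : ℕ} (g : Sp n ℝ) (Z : Siegel n) :
    ‖den g Z.1‖ ^ 2 ≤ ‖trace (imC Z)‖ * ‖trace (imC (g • Z))⁻¹‖ := by
  obtain ⟨S, hS⟩ : ∃ S, imC Z = Sᴴ * S :=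
    exists_eq_conjTranspose_mul_self (posDef_map_complex Z.2.2).posSemidef
  have hrel := den_mul_imC_smul g Z
  set Q := den g Z.1
  set V := imC (g • Z)
  have hSu : IsUnit S.det := by
    have := isUnit_imC Z
    rw [hS, det_mul] at this
    exact isUnit_of_mul_isUnit_right this
  have hSS : S⁻¹ * S = 1 := nonsing_inv_mul _ hSu
  have hSS' : (S⁻¹)ᴴ * Sᴴ = 1 := by
    rw [← conjTranspose_mul, mul_nonsing_inv _ hSu, conjTranspose_one]
  have hV : V⁻¹ = (Q * S⁻¹) * (Q * S⁻¹)ᴴ := by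
    have h1 : (Q * S⁻¹)ᴴ * V * (Q * S⁻¹) = 1 := by
      calc (Q * S⁻¹)ᴴ * V * (Q * S⁻¹) = (S⁻¹)ᴴ * (Qᴴ * V * Q) * S⁻¹ := by
            rw [conjTranspose_mul]
            simp only [Matrix.mul_assoc]
        _ = ((S⁻¹)ᴴ * Sᴴ) * (S * S⁻¹) := by
            rw [hrel, hS]
            simp only [Matrix.mul_assoc]
        _ = 1 := by rw [hSS', mul_nonsing_inv _ hSu, Matrix.one_mul]
    refine Matrix.inv_eq_left_inv ?_
    rw [Matrix.mul_assoc]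
    exact mul_eq_one_comm.1 h1
  have e1 : ‖trace (imC Z)‖ = ‖S‖ ^ 2 := by
    rw [hS, trace_mul_comm, trace_mul_conjTranspose, Complex.norm_real,
      Real.norm_of_nonneg (by positivity)]
  have e2 : ‖trace V⁻¹‖ = ‖Q * S⁻¹‖ ^ 2 := by
    rw [hV, trace_mul_conjTranspose, Complex.norm_real, Real.norm_of_nonneg (by positivity)]
  have e3 : Q = Q * S⁻¹ * S := by rw [Matrix.mul_assoc, hSS, Matrix.mul_one]
  rw [e1, e2, ← mul_pow, mul_comm]
  gcongr
  conv_lhs => rw [e3]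
  exact frobenius_norm_mul _ _

/-- Bounds for real matrices `A`, `B` in terms of `AZ + B`. -/
lemma norm_le_of_norm_mul_add_le {n : ℕ} (A B : Matrix (Fin n) (Fin n) ℝ) (Z : Siegel n)
    {b c : ℝ} (hb : ‖Z.1‖ ≤ b) (hb' : ‖(imC Z)⁻¹‖ ≤ b)
    (hc : ‖A.map (algebraMap ℝ ℂ) * Z.1 + B.map (algebraMap ℝ ℂ)‖ ≤ c) :
    ‖A.map (algebraMap ℝ ℂ)‖ ≤ c * b ∧ ‖B.map (algebraMap ℝ ℂ)‖ ≤ c + c * b * b := by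
  set A' := A.map (algebraMap ℝ ℂ) with hA'
  set B' := B.map (algebraMap ℝ ℂ) with hB'
  set Q := A' * Z.1 + B' with hQ
  have hb0 : 0 ≤ b := (norm_nonneg _).trans hb
  have hc0 : 0 ≤ c := (norm_nonneg _).trans hc
  have hconj : ∀ M : Matrix (Fin n) (Fin n) ℝ,
      (M.map (algebraMap ℝ ℂ)).map (starRingEnd ℂ) = M.map (algebraMap ℝ ℂ) := fun M => by
    ext i j
    simp
  have hZ : Z.1 - Z.1.map (starRingEnd ℂ) = (2 * Complex.I) • imC Z := by
    ext i j
    apply Complex.ext <;> simp [imC]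
    ring
  -- As `A` and `B` are real, conjugation eliminates `B` and isolates `A · Im Z`.
  have h1 : Q - Q.map (starRingEnd ℂ) = (2 * Complex.I) • (A' * imC Z) := by
    rw [hQ, Matrix.map_add _ (map_add _), Matrix.map_mul, hconj, hconj, ← Matrix.mul_smul, ← hZ]
    noncomm_ring
  have h2 : ‖A' * imC Z‖ ≤ c := by
    have hn : ‖Q.map (starRingEnd ℂ)‖ = ‖Q‖ := frobenius_norm_map_eq _ _ fun z => by simp
    have := norm_sub_le Q (Q.map (starRingEnd ℂ))
    rw [hn, h1, norm_smul] at this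
    simp at this
    linarith
  have h3 : ‖A'‖ ≤ c * b := by
    have e : A' = A' * imC Z * (imC Z)⁻¹ := by
      rw [Matrix.mul_assoc, mul_nonsing_inv _ (isUnit_imC Z), Matrix.mul_one]
    rw [e]
    exact (frobenius_norm_mul _ _).trans (by gcongr)
  refine ⟨h3, ?_⟩
  have e : B' = Q - A' * Z.1 := by rw [hQ, add_sub_cancel_left]
  rw [e]
  refine (norm_sub_le _ _).trans (add_le_add hc ((frobenius_norm_mul _ _).trans ?_))
  gcongr

/-- A continuous function on the Siegel space that controls how far a point is from infinity. -/
noncomputable def height {n : ℕ} (Z : Siegel n) : ℝ :=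
  ‖Z.1‖ + ‖(imC Z)⁻¹‖ + ‖trace (imC Z)‖ + ‖trace (imC Z)⁻¹‖

lemma continuous_height {n : ℕ} : Continuous (height : Siegel n → ℝ) := by
  have h1 : Continuous fun Z : Siegel n => Z.1 := continuous_subtype_val
  have h2 : Continuous fun Z : Siegel n => (imC Z)⁻¹ :=
    continuous_matrix_inv continuous_imC isUnit_imC
  exact ((h1.norm.add h2.norm).add continuous_imC.matrix_trace.norm).add h2.matrix_trace.norm

/-- The denominator is at most `b` and the numerator, being `gZ` times the denominator, at most
`b²`. This bounds `A, B, C, D` by `b³`, `b² + b⁴`, `b²`, `b + b³`, and the stated constant majorizes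
all four. -/
lemma norm_blocks_le {n : ℕ} (g : Sp n ℝ) (Z : Siegel n) {b : ℝ} (hZ : height Z ≤ b)
    (hgZ : height (g • Z) ≤ b) :
    (∀ i j, |g.1 i j| ≤ (b + b * b) * (1 + b + b * b)) := by
  have n1 := norm_nonneg Z.1
  have n2 := norm_nonneg (imC Z)⁻¹
  have n3 := norm_nonneg (trace (imC Z))
  have n4 := norm_nonneg (trace (imC Z)⁻¹)
  have m1 := norm_nonneg (g • Z).1
  have m2 := norm_nonneg (imC (g • Z))⁻¹
  have m3 := norm_nonneg (trace (imC (g • Z)))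
  have m4 := norm_nonneg (trace (imC (g • Z))⁻¹)
  rw [height] at hZ hgZ
  have hb : 0 ≤ b := by linarith
  have hQ : ‖den g Z.1‖ ≤ b := by
    refine pow_le_pow_iff_left₀ (norm_nonneg _) hb two_ne_zero |>.1 ?_
    refine (norm_den_sq_le g Z).trans ?_
    rw [sq]
    gcongr <;> linarith
  have hP : ‖num g Z.1‖ ≤ b * b := by
    have h1 : (g • Z).1 * den g Z.1 = num g Z.1 := by
      rw [coe_smul, Matrix.mul_assoc, nonsing_inv_mul _ (isUnit_den g Z), Matrix.mul_one]
    rw [← h1]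
    refine (frobenius_norm_mul _ _).trans ?_
    gcongr
    linarith
  obtain ⟨hA, hB⟩ := norm_le_of_norm_mul_add_le _ _ Z (b := b) (by linarith) (by linarith) hP
  obtain ⟨hC, hD⟩ := norm_le_of_norm_mul_add_le _ _ Z (b := b) (by linarith) (by linarith) hQ
  have key : ∀ (M : Matrix (Fin n) (Fin n) ℝ) (c : ℝ), ‖M.map (algebraMap ℝ ℂ)‖ ≤ c →
      ∀ i j, |M i j| ≤ c := fun M c hM i j => by
    have := (norm_entry_le_frobenius (M.map (algebraMap ℝ ℂ)) i j).trans hM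
    simpa using this
  have p2 : 0 ≤ b * b := by positivity
  have p3 : 0 ≤ b * b * b := by positivity
  have p4 : 0 ≤ b * b * b * b := by positivity
  have e : (b + b * b) * (1 + b + b * b)
      = b + 2 * (b * b) + 2 * (b * b * b) + b * b * b * b := by ring
  rw [e]
  rintro (i | i) (j | j)
  · exact (key _ _ hA i j).trans (by linarith)
  · exact (key _ _ hB i j).trans (by linarith)
  · exact (key _ _ hC i j).trans (by linarith)
  · exact (key _ _ hD i j).trans (by linarith)

end Frobenius

/-- Proper discontinuity, with sublevel sets of `height` in the role of compact sets: there are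
finitely many integral matrices with bounded entries. -/
lemma finite_setOf_height_le {n : ℕ} (b : ℝ) :
    {δ : Sp n ℤ | ∃ Z : Siegel n, height Z ≤ b ∧ height (δ • Z) ≤ b}.Finite := by
  set R : ℤ := ⌈(b + b * b) * (1 + b + b * b)⌉
  let f : Sp n ℤ → (Fin n ⊕ Fin n → Fin n ⊕ Fin n → ℤ) := fun δ => δ.1
  have hf : Function.Injective f := fun δ δ' h => Subtype.ext h
  refine ((Set.finite_Icc (fun _ _ => -R) (fun _ _ => R)).preimage hf.injOn).subset ?_
  rintro δ ⟨Z, h1, h2⟩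
  have h3 : ∀ i j, |δ.1 i j| ≤ R := fun i j => by
    have h := (norm_blocks_le (toReal n δ) Z h1 h2 i j).trans (Int.le_ceil _)
    change |((δ.1 i j : ℤ) : ℝ)| ≤ (R : ℝ) at h
    exact_mod_cast h
  exact ⟨fun i j => (abs_le.1 (h3 i j)).1, fun i j => (abs_le.1 (h3 i j)).2⟩

lemma finite_stabilizer {n : ℕ} (Z : Siegel n) :
    (MulAction.stabilizer (Sp n ℤ) Z : Set (Sp n ℤ)).Finite :=
  (finite_setOf_height_le (height Z)).subset fun δ (hδ : δ • Z = Z) =>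
    ⟨Z, le_rfl, by rw [hδ]⟩

/-- `Γ(4m)` acts freely. -/
lemma eq_one_of_smul_eq {n m : ℕ} {δ : Sp n ℤ} (hδ : δ ∈ Gam n (4 * m)) {Z : Siegel n}
    (h : δ • Z = Z) : δ = 1 := by
  have : Finite (MulAction.stabilizer (Sp n ℤ) Z) := finite_stabilizer Z
  obtain ⟨k, hk, hk'⟩ :=
    -- An element of a finite stabilizer has finite order, and `Γ(4m)` has no torsion.
    (isOfFinOrder_of_finite (⟨δ, h⟩ : MulAction.stabilizer (Sp n ℤ) Z)).exists_pow_eq_one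
  exact eq_one_of_mem_Gam_of_pow_eq_one hδ hk (congrArg Subtype.val hk')

/-- `Γ(4m)` acts freely and discontinuously. -/
lemma exists_isOpen_forall_smul_mem {n m : ℕ} (Z : Siegel n) :
    ∃ W : Set (Siegel n), IsOpen W ∧ Z ∈ W ∧
      ∀ δ ∈ Gam n (4 * m), ∀ w ∈ W, δ • w ∈ W → δ = 1 := by
  -- The margin `1` makes `height < height Z + 1` an open neighbourhood of `Z`. Only the finitely
  -- many `δ ∈ F` can return it to itself, and each is handled by a separate neighbourhood.
  set F := {δ : Sp n ℤ | ∃ w : Siegel n, height w ≤ height Z + 1 ∧ height (δ • w) ≤ height Z + 1}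
  have hF : F.Finite := finite_setOf_height_le _
  have hsep : ∀ δ : Sp n ℤ, ∃ U : Set (Siegel n), IsOpen U ∧ Z ∈ U ∧
      (δ ∈ Gam n (4 * m) → ∀ w ∈ U, δ • w ∈ U → δ = 1) := by
    intro δ
    by_cases h : δ • Z = Z
    · exact ⟨Set.univ, isOpen_univ, trivial, fun hδ _ _ _ => eq_one_of_smul_eq hδ h⟩
    · obtain ⟨U, V, hU, hV, hZU, hZV, hd⟩ := t2_separation h
      refine ⟨V ∩ (δ • ·) ⁻¹' U, hV.inter (hU.preimage (continuous_const_smul δ)), ⟨hZV, hZU⟩,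
        fun _ w hw hw' => ?_⟩
      exact (Set.disjoint_left.1 hd hw.2 hw'.1).elim
  choose U hU hZU hUδ using hsep
  refine ⟨{w | height w < height Z + 1} ∩ ⋂ δ ∈ F, U δ,
    (isOpen_lt continuous_height continuous_const).inter (hF.isOpen_biInter fun δ _ => hU δ),
    ⟨lt_add_one (height Z), Set.mem_iInter₂.2 fun δ _ => hZU δ⟩, fun δ hδ w hw hw' => ?_⟩
  have hδF : δ ∈ F := ⟨w, le_of_lt hw.1, le_of_lt hw'.1⟩
  exact hUδ δ hδ w (Set.mem_iInter₂.1 hw.2 δ hδF) (Set.mem_iInter₂.1 hw'.2 δ hδF)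

/-! ### Real points and translates of the cone -/

lemma tau_toReal {n : ℕ} (g : Sp n ℤ) : tau (toReal n g) = toReal n (tau g) := tau_spMap _ g

lemma tauS_int_smul {n : ℕ} (g : Sp n ℤ) (Z : Siegel n) : tauS (g • Z) = tau g • tauS Z := by
  change tauS (toReal n g • Z) = toReal n (tau g) • tauS Z
  rw [tauS_smul, tau_toReal]

lemma tauS_tauS {n : ℕ} (Z : Siegel n) : tauS (tauS Z) = Z := by
  apply Subtype.ext
  ext i j
  simp [tauS]

/-- Translated by `g⁻¹`, the equation says that `g⁻¹Z` is fixed by `τ`, that is, has zero real part.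
-/
lemma mem_giC_iff {n : ℕ} {g : Sp n ℤ} {Z : Siegel n} :
    Z ∈ giC g ↔ (tau g * g⁻¹) • Z = tauS Z := by
  constructor
  · rintro ⟨Y, rfl⟩
    rw [tauS_int_smul, tauS_iMul, mul_smul, inv_smul_smul]
  · intro h
    have h' : tauS (g⁻¹ • Z) = g⁻¹ • Z := by
      rw [tauS_int_smul, ← h, ← mul_smul, map_inv]
      group
    exact ⟨imPart (g⁻¹ • Z), by rw [iMul_imPart h', smul_inv_smul]⟩

lemma gammaReal_eq_giC {n : ℕ} (g : Sp n ℤ) : gammaReal (toReal n (tau g * g⁻¹)) = giC g :=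
  Set.ext fun _ => mem_giC_iff.symm

lemma X.mk_eq_iff {n N : ℕ} {Z W : Siegel n} :
    X.mk N Z = X.mk N W ↔ ∃ γ ∈ Gam n N, γ • W = Z := by
  rw [X.mk, X.mk, Quotient.eq]
  exact ⟨fun ⟨γ, h⟩ => ⟨γ.1, γ.2, h⟩, fun ⟨γ, hγ, h⟩ => ⟨⟨γ, hγ⟩, h⟩⟩

lemma X.mk_mem_realPts_iff {n N : ℕ} {Z : Siegel n} :
    X.mk N Z ∈ realPts n N ↔ ∃ γ ∈ Gam n N, γ • Z = tauS Z :=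
  X.mk_eq_iff (Z := tauS Z)

lemma realPts_eq {n N : ℕ} :
    realPts n N = X.mk N '' (⋃ γ ∈ Gam n N, gammaReal (toReal n γ)) := by
  ext x
  constructor
  · induction x using Quotient.inductionOn with
    | h Z =>
      intro h
      obtain ⟨γ, hγ, h'⟩ := X.mk_mem_realPts_iff.1 h
      exact ⟨Z, Set.mem_iUnion₂.2 ⟨γ, hγ, h'⟩, rfl⟩
  · rintro ⟨Z, hZ, rfl⟩
    obtain ⟨γ, hγ, h'⟩ := Set.mem_iUnion₂.1 hZ
    exact X.mk_mem_realPts_iff.2 ⟨γ, hγ, h'⟩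

/-- An element of `Γ(4m)` that carries a point to its conjugate is a cocycle. -/
lemma tau_mul_self_eq_one {n m : ℕ} {γ : Sp n ℤ} (hγ : γ ∈ Gam n (4 * m)) {Z : Siegel n}
    (h : γ • Z = tauS Z) : tau γ * γ = 1 := by
  refine eq_one_of_smul_eq (mul_mem (tau_mem_Gam hγ) hγ) (Z := Z) ?_
  rw [mul_smul, h, ← tauS_int_smul, h, tauS_tauS]

/-- Freeness converts an equality of points into one of group elements; cocycle identities are read
off from the action in this way. -/
lemma eq_of_smul_eq {n m : ℕ} {γ δ : Sp n ℤ} (hγ : γ ∈ Gam n (4 * m)) (hδ : δ ∈ Gam n (4 * m))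
    {Z : Siegel n} (h : γ • Z = δ • Z) : γ = δ := by
  refine (inv_mul_eq_one.1 (eq_one_of_smul_eq (mul_mem (inv_mem hδ) hγ) (Z := Z) ?_)).symm
  rw [mul_smul, h, inv_smul_smul]

lemma exists_mem_giC {n m : ℕ} {Z : Siegel n} (h : X.mk (4 * m) Z ∈ realPts n (4 * m)) :
    ∃ g ∈ Gam2 n m, Z ∈ giC g := by
  obtain ⟨γ, hγ, h'⟩ := X.mk_mem_realPts_iff.1 h
  obtain ⟨g, hg, rfl⟩ := exists_mem_Gam2_tau_mul_inv hγ (tau_mul_self_eq_one hγ h')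
  exact ⟨g, hg, mem_giC_iff.2 h'⟩

/-! ### Double cosets -/

lemma Index.mk_eq_iff {n m : ℕ} {g h : Gam2 n m} :
    Index.mk g = Index.mk h ↔
      ∃ γ ∈ Gam n (4 * m), ∃ A ∈ GamL n 2, h.1 = γ * g.1 * glEmb n ℤ A := by
  rw [Index.mk, Index.mk, DoubleCoset.eq]
  constructor
  · rintro ⟨γ, hγ, k, hk, e⟩
    obtain ⟨A, hA, hAk⟩ := Subgroup.mem_subgroupOf.1 hk
    refine ⟨γ, hγ, A, hA, ?_⟩
    rw [hAk]
    exact congrArg Subtype.val e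
  · rintro ⟨γ, hγ, A, hA, e⟩
    exact ⟨⟨γ, Gam_le_Gam2 n m hγ⟩, hγ, ⟨glEmb n ℤ A, glEmb_mem_Gam2_iff.2 hA⟩,
      ⟨A, hA, rfl⟩, Subtype.ext e⟩

/-- Already `Γ(4m)\Γ_{2m}(2)` embeds in `Sp(2n, ℤ/4m)`, which is finite as `m ≠ 0`. -/
instance finite_index (n m : ℕ) [NeZero m] : Finite (Index n m) := by
  have : NeZero (4 * m) := ⟨mul_ne_zero four_ne_zero (NeZero.ne m)⟩
  have hsurj : ∀ d : Index n m, ∃ g, Index.mk g = d := fun d => Quotient.exists_rep d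
  choose r hr using hsurj
  refine Finite.of_injective
    (fun d => (spMap n (Int.castRingHom (ZMod (4 * m))) (r d).1)) fun d d' h => ?_
  rw [← hr d, ← hr d', Index.mk_eq_iff]
  refine ⟨(r d').1 * (r d).1⁻¹, ?_, 1, one_mem _, by rw [map_one]; group⟩
  rw [Gam, MonoidHom.mem_ker, map_mul, map_inv, mul_inv_eq_one]
  exact h.symm

lemma tau_mul_inv_mul {n : ℕ} (γ g : Sp n ℤ) (A : GL (Fin n) ℤ) :
    tau (γ * g * glEmb n ℤ A) * (γ * g * glEmb n ℤ A)⁻¹ = tau γ * (tau g * g⁻¹) * γ⁻¹ := by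
  rw [map_mul, map_mul, tau_glEmb]
  group

/-- The hypothesis says exactly that `(δg)⁻¹h` is fixed by `τ`, so it lies in `GL(n, ℤ)`. It also
lies in `Γ_{2m}(2)`, which gives level `2`. -/
lemma exists_eq_mul_glEmb {n m : ℕ} {g h δ : Sp n ℤ} (hg : g ∈ Gam2 n m) (hh : h ∈ Gam2 n m)
    (hδ : δ ∈ Gam n (4 * m)) (e : tau h * h⁻¹ = tau δ * (tau g * g⁻¹) * δ⁻¹) :
    ∃ A ∈ GamL n 2, h = δ * g * glEmb n ℤ A := by
  obtain ⟨A, hA⟩ := exists_glEmb_eq_of_tau_eq (g := (δ * g)⁻¹ * h) <| by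
    rw [map_mul, map_inv, map_mul, mul_inv_eq_iff_eq_mul.1 e]
    group
  refine ⟨A, ?_, by rw [hA, mul_inv_cancel_left]⟩
  rw [← glEmb_mem_Gam2_iff (m := m), hA]
  exact mul_mem (inv_mem (mul_mem (Gam_le_Gam2 n m hδ) hg)) hh

/-! ### Cohomology -/

lemma conjAe_ne_one : Complex.conjAe ≠ 1 := fun h => by
  have := congrArg Complex.im (DFunLike.congr_fun h Complex.I)
  norm_num at this

lemma eq_one_or_eq_conjAe (σ : ℂ ≃ₐ[ℝ] ℂ) : σ = 1 ∨ σ = Complex.conjAe := by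
  rcases Complex.real_algHom_eq_id_or_conj σ.toAlgHom with h | h
  · exact Or.inl (AlgEquiv.ext fun z => DFunLike.congr_fun h z)
  · exact Or.inr (AlgEquiv.ext fun z => DFunLike.congr_fun h z)

lemma conjAe_mul_conjAe : Complex.conjAe * Complex.conjAe = 1 :=
  AlgEquiv.ext fun z => Complex.conj_conj z

lemma galAction_conjAe (n N : ℕ) : galAction n N Complex.conjAe = tauGam n N :=
  if_neg conjAe_ne_one

lemma Cocycle.map_one {G A : Type} [Group G] [Group A] {ρ : G →* MulAut A} (f : Cocycle ρ) :
    f.toFun 1 = 1 := by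
  have := f.cocycle 1 1
  rw [mul_one, _root_.map_one, MulAut.one_apply] at this
  exact (left_eq_mul.1 this)

lemma Cocycle.tau_mul_self {n N : ℕ} (f : Cocycle (galAction n N)) :
    tau (f.toFun Complex.conjAe : Sp n ℤ) * f.toFun Complex.conjAe = 1 := by
  have := f.cocycle Complex.conjAe Complex.conjAe
  rw [conjAe_mul_conjAe, f.map_one, galAction_conjAe] at this
  exact (congrArg Subtype.val this).symm

open Classical in
/-- The cocycle `f_γ`. -/
noncomputable def galCocycle {n N : ℕ} (γ : Gam n N) (h : tau γ.1 * γ.1 = 1) :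
    Cocycle (galAction n N) where
  toFun σ := if σ = 1 then 1 else γ
  cocycle s t := by
    have h' : 1 = tauGam n N γ * γ := Subtype.ext h.symm
    rcases eq_one_or_eq_conjAe s with rfl | rfl <;> rcases eq_one_or_eq_conjAe t with rfl | rfl <;>
      simp [conjAe_ne_one, conjAe_mul_conjAe, galAction_conjAe, ← h']

lemma galCocycle_conjAe {n N : ℕ} (γ : Gam n N) (h : tau γ.1 * γ.1 = 1) :
    (galCocycle γ h).toFun Complex.conjAe = γ :=
  if_neg conjAe_ne_one

/-- The Galois group has order two and cocycles are trivial at `1`, so only the value at conjugation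
matters. -/
lemma cohomologous_iff {n N : ℕ} {f f' : Cocycle (galAction n N)} :
    (Quotient.mk (cohomologous (galAction n N)) f = Quotient.mk _ f') ↔
      ∃ δ ∈ Gam n N, (f'.toFun Complex.conjAe : Sp n ℤ) =
        tau δ * (f.toFun Complex.conjAe : Sp n ℤ) * δ⁻¹ := by
  rw [Quotient.eq]
  constructor
  · rintro ⟨h, hh⟩
    refine ⟨h.1, h.2, ?_⟩
    have := hh Complex.conjAe
    rw [galAction_conjAe] at this
    exact congrArg Subtype.val this
  · rintro ⟨δ, hδ, e⟩
    refine ⟨⟨δ, hδ⟩, fun s => ?_⟩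
    rcases eq_one_or_eq_conjAe s with rfl | rfl
    · simp [Cocycle.map_one]
    · rw [galAction_conjAe]
      exact Subtype.ext e

/-- The cocycle attached to an element of `Γ_{2m}(2)`. -/
noncomputable def cocycleOf {n m : ℕ} (g : Gam2 n m) : Cocycle (galAction n (4 * m)) :=
  galCocycle ⟨tau g.1 * g.1⁻¹, tau_mul_inv_mem_Gam g.2⟩ (by
    rw [map_mul, map_inv, tau_tau]
    group)

lemma cocycleOf_conjAe {n m : ℕ} (g : Gam2 n m) :
    ((cocycleOf g).toFun Complex.conjAe : Sp n ℤ) = tau g.1 * g.1⁻¹ :=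
  congrArg Subtype.val (galCocycle_conjAe _ _)

/-- One direction makes the map on double cosets well defined, the other makes it injective. -/
lemma mk_cocycleOf_eq_iff {n m : ℕ} {g h : Gam2 n m} :
    (Quotient.mk (cohomologous (galAction n (4 * m))) (cocycleOf g)
      = Quotient.mk _ (cocycleOf h)) ↔ Index.mk g = Index.mk h := by
  rw [cohomologous_iff, Index.mk_eq_iff, cocycleOf_conjAe, cocycleOf_conjAe]
  constructor
  · rintro ⟨δ, hδ, e⟩
    exact ⟨δ, hδ, exists_eq_mul_glEmb g.2 h.2 hδ e⟩
  · rintro ⟨γ, hγ, A, -, e⟩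
    exact ⟨γ, hγ, by rw [e, tau_mul_inv_mul]⟩

/-- The bijection between double cosets and cohomology classes. -/
noncomputable def indexEquiv (n m : ℕ) : Index n m ≃ GalH1 n (4 * m) :=
  Equiv.ofBijective
    (Quotient.lift (fun g => Quotient.mk _ (cocycleOf g)) fun _ _ h =>
      mk_cocycleOf_eq_iff.2 (Quotient.sound h)) <| by
    constructor
    · intro d d' h
      induction d using Quotient.inductionOn with
      | h g =>
        induction d' using Quotient.inductionOn with
        | h g' => exact mk_cocycleOf_eq_iff.1 h
    · intro c
      induction c using Quotient.inductionOn with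
      | h f =>
        obtain ⟨g, hg, e⟩ :=
          exists_mem_Gam2_tau_mul_inv (f.toFun Complex.conjAe).2 f.tau_mul_self
        refine ⟨Index.mk ⟨g, hg⟩, cohomologous_iff.2 ⟨1, one_mem _, ?_⟩⟩
        rw [cocycleOf_conjAe, e, map_one, one_mul, inv_one, mul_one]

lemma indexEquiv_mk {n m : ℕ} (g : Gam2 n m) :
    indexEquiv n m (Index.mk g) = Quotient.mk _ (cocycleOf g) := rfl

/-! ### The pieces -/

lemma coe_GL_smul {n : ℕ} (A : GL (Fin n) ℤ) (Y : Cone n) :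
    (A • Y).1 = A.1.map (Int.castRingHom ℝ) * Y.1 * (A.1.map (Int.castRingHom ℝ))ᵀ := rfl

lemma coe_iMul {n : ℕ} (Y : Cone n) :
    (iMul Y).1 = Complex.I • Y.1.map (algebraMap ℝ ℂ) := rfl

lemma glEmb_smul_iMul {n : ℕ} (A : GL (Fin n) ℤ) (Y : Cone n) :
    glEmb n ℤ A • iMul Y = iMul (A • Y) := by
  set g := toReal n (glEmb n ℤ A) with hg
  change g • iMul Y = _
  have hblocks : g.1 = fromBlocks (A.1.map (Int.castRingHom ℝ)) 0 0
      ((A⁻¹).1.map (Int.castRingHom ℝ))ᵀ := by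
    change ((glEmb n ℤ A).1).map (Int.castRingHom ℝ) = _
    rw [coe_glEmb, fromBlocks_map]
    simp [transpose_map]
  have hA : (A⁻¹).1.map (Int.castRingHom ℝ) * A.1.map (Int.castRingHom ℝ) = 1 := by
    rw [← Matrix.map_mul, ← Units.val_mul, inv_mul_cancel, Units.val_one,
      Matrix.map_one _ (map_zero _) (map_one _)]
  have key : (iMul (A • Y)).1 * den g (iMul Y).1 = num g (iMul Y).1 := by
    rw [num, den, hblocks, toBlocks_fromBlocks₁₁, toBlocks_fromBlocks₁₂, toBlocks_fromBlocks₂₁,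
      toBlocks_fromBlocks₂₂, Matrix.map_zero _ (map_zero _), Matrix.zero_mul, zero_add, add_zero,
      coe_iMul, coe_iMul, coe_GL_smul]
    simp only [Matrix.smul_mul, Matrix.mul_smul]
    rw [← Matrix.map_mul, Matrix.mul_assoc, ← transpose_mul, hA, transpose_one, Matrix.mul_one,
      Matrix.map_mul]
  apply Subtype.ext
  rw [coe_smul, ← key, Matrix.mul_assoc, mul_nonsing_inv _ (isUnit_den _ _), Matrix.mul_one]

lemma iMul_injective {n : ℕ} : Function.Injective (iMul : Cone n → Siegel n) :=
  Function.LeftInverse.injective imPart_iMul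

/-- A point of `g·iC_n`. -/
noncomputable def giC.mk {n : ℕ} (g : Sp n ℤ) (Y : Cone n) : giC g := ⟨g • iMul Y, Y, rfl⟩

lemma coe_giC_mk {n : ℕ} (g : Sp n ℤ) (Y : Cone n) : (giC.mk g Y).1 = g • iMul Y := rfl

lemma Piece.mk_eq_iff {n N : ℕ} {g : Sp n ℤ} {Z W : giC g} :
    (Quotient.mk _ Z : Piece N g) = Quotient.mk _ W ↔
      ∃ A ∈ GamL n N, (g * glEmb n ℤ A * g⁻¹) • W.1 = Z.1 := by
  rw [Quotient.eq]
  constructor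
  · rintro ⟨⟨_, _, ⟨A, hA, rfl⟩, rfl⟩, h⟩
    exact ⟨A, hA, h⟩
  · rintro ⟨A, hA, h⟩
    exact ⟨⟨g * glEmb n ℤ A * g⁻¹, _, ⟨A, hA, rfl⟩, rfl⟩, h⟩

lemma Piece.mk_giC_mk_eq_iff {n N : ℕ} {g : Sp n ℤ} {Y Y' : Cone n} :
    (Quotient.mk _ (giC.mk g Y) : Piece N g) = Quotient.mk _ (giC.mk g Y') ↔
      ∃ A ∈ GamL n N, A • Y' = Y := by
  rw [Piece.mk_eq_iff]
  refine exists_congr fun A => and_congr_right fun _ => ?_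
  rw [coe_giC_mk, coe_giC_mk, ← mul_smul, inv_mul_cancel_right, mul_smul, smul_left_cancel_iff,
    glEmb_smul_iMul, iMul_injective.eq_iff]

/-- `Y ↦ g·iY` is a homeomorphism of `C_n` onto `g·iC_n`. -/
noncomputable def coneHomeomorph {n : ℕ} (g : Sp n ℤ) : Cone n ≃ₜ giC g where
  toFun := giC.mk g
  invFun Z := imPart (g⁻¹ • Z.1)
  left_inv Y := by
    beta_reduce
    rw [coe_giC_mk, inv_smul_smul, imPart_iMul]
  right_inv := by
    rintro ⟨_, Y, rfl⟩
    simp only [inv_smul_smul, imPart_iMul]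
    rfl
  continuous_toFun := ((continuous_const_smul g).comp continuous_iMul).subtype_mk _
  continuous_invFun :=
    continuous_imPart.comp ((continuous_const_smul g⁻¹).comp continuous_subtype_val)

lemma orbitRel_GamL_iff {n N : ℕ} {Y Y' : Cone n} :
    MulAction.orbitRel (GamL n N) (Cone n) Y Y' ↔ ∃ A ∈ GamL n N, A • Y' = Y :=
  ⟨fun ⟨A, h⟩ => ⟨A.1, A.2, h⟩, fun ⟨A, hA, h⟩ => ⟨⟨A, hA⟩, h⟩⟩

/-- Each piece is a copy of `Γ_ℓ(N) \ C_n`. -/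
noncomputable def pieceHomeomorph {n : ℕ} (N : ℕ) (g : Sp n ℤ) : ConeQuot n N ≃ₜ Piece N g :=
  Homeomorph.Quotient.congr (coneHomeomorph g) fun Y Y' => by
    refine orbitRel_GamL_iff.trans ?_
    rw [← Piece.mk_giC_mk_eq_iff, Quotient.eq]
    rfl

/-- The map from a piece to the real points. -/
noncomputable def pieceMap {n m : ℕ} {g : Sp n ℤ} (hg : g ∈ Gam2 n m) :
    Piece (4 * m) g → realPts n (4 * m) :=
  Quotient.lift (fun Z : giC g => ⟨X.mk (4 * m) Z.1,
    X.mk_mem_realPts_iff.2 ⟨_, tau_mul_inv_mem_Gam hg, mem_giC_iff.1 Z.2⟩⟩) fun Z W h => by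
      obtain ⟨A, hA, h'⟩ := Piece.mk_eq_iff.1 (Quotient.sound h)
      exact Subtype.ext (X.mk_eq_iff.2
        ⟨_, (Gam_normal n (4 * m)).conj_mem _ (glEmb_mem_Gam_iff.2 hA) g, h'⟩)

lemma continuous_pieceMap {n m : ℕ} {g : Sp n ℤ} (hg : g ∈ Gam2 n m) :
    Continuous (pieceMap hg) :=
  Continuous.quotient_lift ((continuous_quotient_mk'.comp continuous_subtype_val).subtype_mk _) _

lemma isOpenMap_X_mk (n N : ℕ) : IsOpenMap (X.mk N : Siegel n → X n N) :=
  have : ContinuousConstSMul (Gam n N) (Siegel n) :=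
    ⟨fun γ => continuous_const_smul (γ.1 : Sp n ℤ)⟩
  isOpenMap_quotient_mk'_mul

/-- Near a point of `g·iC_n` there are no other real points. If `γ'w = τ(w)` with `w` close to `Z`,
then `γ⁻¹γ'` carries `w` to `γ⁻¹τ(w)`, which is close to `γ⁻¹τ(Z) = Z`. Discontinuity gives `γ' =
γ`, so `w ∈ g·iC_n`. -/
lemma isOpenMap_pieceMap {n m : ℕ} {g : Sp n ℤ} (hg : g ∈ Gam2 n m) :
    IsOpenMap (pieceMap hg) := by
  intro U hU
  obtain ⟨O, hO, hOU⟩ := isOpen_induced_iff.1 (hU.preimage continuous_quotient_mk')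
  rw [isOpen_iff_forall_mem_open]
  rintro _ ⟨u, hu, rfl⟩
  induction u using Quotient.inductionOn with
  | h Z =>
    set γ := tau g * g⁻¹ with hγdef
    have hγ : γ ∈ Gam n (4 * m) := tau_mul_inv_mem_Gam hg
    obtain ⟨W, hW, hZW, hfree⟩ := exists_isOpen_forall_smul_mem (m := m) Z.1
    have hγZ : γ⁻¹ • tauS Z.1 = Z.1 := by rw [← mem_giC_iff.1 Z.2, inv_smul_smul]
    -- The last condition keeps `γ⁻¹τ(w)` in `W`, so that discontinuity on `W` applies to `γ⁻¹γ'`.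
    set W' := O ∩ W ∩ (fun w => γ⁻¹ • tauS w) ⁻¹' W with hW'
    have hW'o : IsOpen W' := (hO.inter hW).inter
      (hW.preimage ((continuous_const_smul γ⁻¹).comp continuous_tauS))
    have hZO : Z.1 ∈ O := by
      have : Z ∈ Subtype.val ⁻¹' O := by
        rw [hOU]
        exact hu
      exact this
    refine ⟨Subtype.val ⁻¹' (X.mk (4 * m) '' W'), ?_,
      (isOpenMap_X_mk _ _ W' hW'o).preimage continuous_subtype_val,
      ⟨Z.1, ⟨⟨hZO, hZW⟩, ?_⟩, rfl⟩⟩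
    · rintro ⟨_, hx⟩ ⟨w, ⟨⟨hwO, hwW⟩, hwW'⟩, rfl⟩
      obtain ⟨γ', hγ', h'⟩ := X.mk_mem_realPts_iff.1 hx
      have e : γ⁻¹ * γ' = 1 := hfree _ (mul_mem (inv_mem hγ) hγ') w hwW (by
        rw [mul_smul, h']
        exact hwW')
      have hw : w ∈ giC g := by
        rw [mem_giC_iff, ← h', ← inv_mul_eq_one.1 e]
      have hwU : (⟨w, hw⟩ : giC g) ∈ Subtype.val ⁻¹' O := hwO
      rw [hOU] at hwU
      exact ⟨_, hwU, rfl⟩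
    · rw [Set.mem_preimage, hγZ]
      exact hZW

/-- Translates of the cone that meet modulo `Γ(4m)` belong to the same double coset. -/
lemma exists_glEmb_of_smul_eq {n m : ℕ} {g h δ : Sp n ℤ} (hg : g ∈ Gam2 n m) (hh : h ∈ Gam2 n m)
    (hδ : δ ∈ Gam n (4 * m)) {Z : Siegel n} (hZ : Z ∈ giC g) (hδZ : δ • Z ∈ giC h) :
    ∃ A ∈ GamL n 2, h = δ * g * glEmb n ℤ A := by
  -- Both sides of the cocycle equation carry `δZ` to `τ(δZ)`, so they agree by freeness.
  refine exists_eq_mul_glEmb hg hh hδ (eq_of_smul_eq (tau_mul_inv_mem_Gam hh)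
    (mul_mem (mul_mem (tau_mem_Gam hδ) (tau_mul_inv_mem_Gam hg)) (inv_mem hδ)) (Z := δ • Z) ?_)
  rw [mem_giC_iff.1 hδZ, tauS_int_smul, mul_smul, inv_smul_smul, mul_smul, mem_giC_iff.1 hZ]

/-- An element `δ` of `Γ(4m)` identifying two points of `g·iC_n` must be `gA⁻¹g⁻¹` with `A ∈ GL(n,
ℤ)`. Normality of `Γ(4m)` then puts `A⁻¹` in `Γ_ℓ(4m)`. -/
lemma pieceMap_injective {n m : ℕ} {g : Sp n ℤ} (hg : g ∈ Gam2 n m) :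
    Function.Injective (pieceMap hg) := by
  intro p q hpq
  induction p using Quotient.inductionOn with
  | h Z =>
    induction q using Quotient.inductionOn with
    | h W =>
      obtain ⟨δ, hδ, e⟩ := X.mk_eq_iff.1 (congrArg Subtype.val hpq)
      obtain ⟨A, -, hA⟩ := exists_glEmb_of_smul_eq hg hg hδ W.2 (e ▸ Z.2)
      have hδA : δ = g * glEmb n ℤ A⁻¹ * g⁻¹ := by
        rw [map_inv, eq_mul_inv_iff_mul_eq, eq_mul_inv_iff_mul_eq]
        exact hA.symm
      refine Piece.mk_eq_iff.2 ⟨A⁻¹, ?_, hδA ▸ e⟩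
      rw [← glEmb_mem_Gam_iff]
      have := (Gam_normal n (4 * m)).conj_mem _ hδ g⁻¹
      rw [hδA] at this
      convert this using 1
      group

/-! ### Assembling the pieces into `X_ℝ` -/

section Decomposition

variable {n m : ℕ} (r : Index n m → Gam2 n m)

/-- The map from the disjoint union of the pieces to the real points. -/
noncomputable def sigmaPieceMap : (Σ d : Index n m, Piece (4 * m) (r d).1) → realPts n (4 * m) :=
  fun p => pieceMap (r p.1).2 p.2

lemma sigmaPieceMap_injective (hr : ∀ d, Index.mk (r d) = d) :
    Function.Injective (sigmaPieceMap r) := by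
  rintro ⟨d, p⟩ ⟨d', p'⟩ h
  obtain rfl : d = d' := by
    induction p using Quotient.inductionOn with
    | h Z =>
      induction p' using Quotient.inductionOn with
      | h W =>
        obtain ⟨δ, hδ, e⟩ := X.mk_eq_iff.1 (congrArg Subtype.val h)
        rw [← hr d, ← hr d', eq_comm, Index.mk_eq_iff]
        exact ⟨δ, hδ, exists_glEmb_of_smul_eq (r d').2 (r d).2 hδ W.2 (e ▸ Z.2)⟩
  exact congrArg (Sigma.mk d) (pieceMap_injective (r d).2 h)

lemma sigmaPieceMap_surjective (hr : ∀ d, Index.mk (r d) = d) :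
    Function.Surjective (sigmaPieceMap r) := by
  rintro ⟨x, hx⟩
  induction x using Quotient.inductionOn with
  | h Z =>
    obtain ⟨g, hg, Y, rfl⟩ := exists_mem_giC hx
    obtain ⟨γ, hγ, A, -, e⟩ := Index.mk_eq_iff.1 (hr (Index.mk ⟨g, hg⟩)).symm
    -- The chosen representative is `γgA`, so the point `g·iY` becomes `γgA·i(A⁻¹Y)` after moving it
    -- by `γ`.
    refine ⟨⟨Index.mk ⟨g, hg⟩, Quotient.mk _ (giC.mk _ (A⁻¹ • Y))⟩, Subtype.ext ?_⟩
    refine X.mk_eq_iff.2 ⟨γ, hγ, ?_⟩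
    rw [coe_giC_mk, ← glEmb_smul_iMul, ← mul_smul, ← mul_smul, e, map_inv, mul_inv_cancel_right]

/-- The real points are the disjoint union of the pieces. -/
noncomputable def sigmaPieceHomeomorph (hr : ∀ d, Index.mk (r d) = d) :
    (Σ d : Index n m, Piece (4 * m) (r d).1) ≃ₜ realPts n (4 * m) :=
  (Equiv.ofBijective (sigmaPieceMap r)
    ⟨sigmaPieceMap_injective r hr, sigmaPieceMap_surjective r hr⟩).toHomeomorphOfContinuousOpen
    (continuous_sigma fun d => continuous_pieceMap (r d).2)
    (isOpenMap_sigma.2 fun d => isOpenMap_pieceMap (r d).2)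

end Decomposition

end SiegelReal

open SiegelReal
theorem mainTheorem1 (n m : ℕ) (hm : 1 ≤ m) :
    -- the real points are the image of the `Γ(4m)`-real points
    realPts n (4 * m) = X.mk (4 * m) '' (⋃ γ ∈ Gam n (4 * m), gammaReal (toReal n γ)) ∧
    -- the index set is finite
    Finite (Index n m) ∧
    -- the index set is `H¹(ℂ/ℝ, Γ(4m))`, by `g ↦ [f_γ]` with `γ = τ(g) g⁻¹`
    (∃ e : Index n m ≃ GalH1 n (4 * m), ∀ g : Gam2 n m, ∃ f : Cocycle (galAction n (4 * m)),
      (f.toFun Complex.conjAe : Sp n ℤ) = tau g.1 * g.1⁻¹ ∧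
        e (Index.mk g) = Quotient.mk _ f) ∧
    -- the locus of `γ = τ(g) g⁻¹ ∈ Γ(4m)` is `g·iC_n`
    (∀ g ∈ Gam2 n m, tau g * g⁻¹ ∈ Gam n (4 * m) ∧
      gammaReal (toReal n (tau g * g⁻¹)) = giC g) ∧
    -- each piece is a copy of `Γ_ℓ(4m) \ C_n`
    (∀ g ∈ Gam2 n m, ∃ φ : ConeQuot n (4 * m) ≃ₜ Piece (4 * m) g,
      ∀ Y : Cone n, φ (Quotient.mk _ Y) = Quotient.mk _ ⟨g • iMul Y, Y, rfl⟩) ∧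
    -- `X_ℝ` is the disjoint union of the pieces, for every choice of representatives
    (∀ r : Index n m → Gam2 n m, (∀ d, Index.mk (r d) = d) →
      ∃ Φ : (Σ d : Index n m, Piece (4 * m) (r d).1) ≃ₜ realPts n (4 * m),
        ∀ (d : Index n m) (Z : giC (r d).1),
          (Φ ⟨d, Quotient.mk _ Z⟩ : X n (4 * m)) = X.mk (4 * m) Z.1) := by
  have : NeZero m := ⟨by omega⟩
  exact ⟨realPts_eq, finite_index n m,
    ⟨indexEquiv n m, fun g => ⟨cocycleOf g, cocycleOf_conjAe g, indexEquiv_mk g⟩⟩,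
    fun g hg => ⟨tau_mul_inv_mem_Gam hg, gammaReal_eq_giC g⟩,
    fun g _ => ⟨pieceHomeomorph (4 * m) g, fun _ => rfl⟩,
    fun r hr => ⟨sigmaPieceHomeomorph r hr, fun _ _ => rfl⟩⟩
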